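/- All manifolds are finite dimensional, Hausdorff, second countable and without boundary, and everything is $C^\infty$. **Discrete tangent bundles.** A discrete tangent bundle of an $n$-dimensional manifold $\mathcal Q$ is a $2n$-dimensional manifold $\mathcal V$ with submersions $\partial^+,\partial^-:\mathcal V\to\mathcal Q$ such that $\ker T\partial^+\cap\ker T\partial^-=0$ and such that for every $q\in\mathcal Q$ there is exactly one $v\in\mathcal V$ with $\partial^+(v)=\partial^-(v)=q$. Put $\operatorname{vert}^{+}=\ker T\partial^{+}$ and $\operatorname{vert}^{-}=\ker T\partial^{-}$. For $v\in\mathcal V$, a vector $\delta q\in T_{\partial^+(v)}\mathcal Q$ has a unique lift $\delta q^+\in\operatorname{vert}^-_v$ with $T\partial^+(\delta q^+)=\delta q$, and a vector $\delta q\in T_{\partial^-(v)}\mathcal Q$ has a unique lift $\delta q^-\in\operatorname{vert}^+_v$ with $T\partial^-(\delta q^-)=\delta q$; for $\delta v\in T_v\mathcal V$ put $\delta v^{+}=(T\partial^{+}\delta v)^{+}$ and $\delta v^{-}=(T\partial^{-}\delta v)^{-}$, so that $\delta v=\delta v^++\delta v^-$. For a one-form $\sigma$ on $\mathcal V$, $v\in\mathcal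 V$, $\delta q\in T_{\partial^-(v)}\mathcal Q$ and $\delta\tilde q\in T_{\partial^+(v)}\mathcal Q$, let $d^\pm\sigma(v)(\delta q,\delta\tilde q)$ be the derivative at $v$, in the direction $\delta\tilde q^+$, of the function $\sigma(X)$, where $X$ is any local vector field with values in $\operatorname{vert}^+$ that lifts, through $\partial^-$, a local vector field on $\mathcal Q$ extending $\delta q$ (the value does not depend on the choice). **Discrete constrained Lagrangian systems.** A DCLS $(\mathcal V,\partial^+,\partial^-,\sigma_d,\mathcal D_d,\mathcal E_d)$ consists of a discrete tangent bundle of $\mathcal Q$, a one-form $\sigma_d$ on $\mathcal V$, an embedded submanifold $\mathcal D_d\subseteq\mathcal V$ such that $\partial^+|\mathcal D_d$ and $\partial^-|\mathcal D_d$ are submersions, and a subbundle $\mathcal E_d$ of $(\partial^+|\mathcal D_d)^*(T\mathcal Q)$. It has linear constraints if there is a constant rank distribution $\mathcal D^{\mathcal Q}_d$ on $\mathcal Q$ such that $(\mathcal E_d)_v=(\mathcal D^{\mathcal Q}_d)_{\partial^+(v)}$ for all $v\in\mathcal D_d$; for every $v\in\mathcal D_d$ there is a piecewise smooth curve tangent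 to $\mathcal D_d^{\mathcal Q}$ from $\partial^-(v)$ to $\partial^+(v)$; and $\dim\mathcal D_d=\dim\mathcal Q+\operatorname{rank}\mathcal D_d^{\mathcal Q}$. It is holonomic if moreover $\mathcal D_d^{\mathcal Q}$ is involutive and $d\sigma_d=0$. **Regularity.** $\sigma_d$ is regular$^-$ if for all $v,\tilde v\in\mathcal D_d$ with $\partial^+(v)=\partial^-(\tilde v)$ and all $\delta q\in T\partial^-(\operatorname{vert}^+_{\tilde v}\cap T_{\tilde v}\mathcal D_d)$: if $d^\pm\sigma_d(\tilde v)(\delta q,\delta\tilde q)=0$ for all $\delta\tilde q\in(\mathcal E_d)_{\tilde v}$, then $\delta q=0$. It is regular$^+$ if for all such $v,\tilde v$ and all $\delta\tilde q\in T\partial^+(\operatorname{vert}^-_{\tilde v}\cap T_{\tilde v}\mathcal D_d)$: if $d^\pm\sigma_d(\tilde v)(\delta q,\delta\tilde q)=0$ for all $\delta q\in(\mathcal E_d)_{v}$, then $\delta\tilde q=0$. It is regular$^\pm$ if it is both regular$^-$ and regular$^+$. **Two-forms.** Let $\theta^+_{\sigma_d}(v)\,\delta v=\sigma_d(v)\,\delta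 v^+$, $\theta^-_{\sigma_d}(v)\,\delta v=-\sigma_d(v)\,\delta v^-$, $\omega^+_{\sigma_d}=-d\theta^+_{\sigma_d}$ and $\omega^-_{\sigma_d}=-d\theta^-_{\sigma_d}$. For $v\in\mathcal D_d$ let $$(\mathcal K^0_{\mathcal D_d})_v=\{\delta v\in T_v\mathcal V:\ T\partial^-(\delta v)\in(\mathcal D_d^{\mathcal Q})_{\partial^-(v)},\ T\partial^+(\delta v)\in(\mathcal D_d^{\mathcal Q})_{\partial^+(v)}\}.$$ **Theorem.** Let $(\mathcal V,\partial^+,\partial^-,\sigma_d,\mathcal D_d,\mathcal E_d)$ be a holonomic DCLS with constraint distribution $\mathcal D_d^{\mathcal Q}$, and suppose that for every $\tilde v\in\mathcal D_d$ there is a $v\in\mathcal D_d$ with $\partial^+(v)=\partial^-(\tilde v)$. Then $\omega^+_{\sigma_d}=\omega^-_{\sigma_d}=:\omega_{\sigma_d}$, and $\sigma_d$ is regular$^\pm$ if and only if $\omega_{\sigma_d}$ is nondegenerate on $\mathcal K^0_{\mathcal D_d}$, i.e. for every $v\in\mathcal D_d$ the only $\delta v\in(\mathcal K^0_{\mathcal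 D_d})_v$ with $\omega_{\sigma_d}(\delta v,\delta w)=0$ for all $\delta w\in(\mathcal K^0_{\mathcal D_d})_v$ is $\delta v=0$. -/

import Mathlib

open Set Topology
open scoped Manifold ContDiff

noncomputable section

namespace DiscreteMechanics

/-! ### Smooth maps, distributions and reachability

`𝓡 n` is the model of boundaryless `n`-dimensional manifolds, `TangentSpace (𝓡 n) q` is the
tangent space at `q`, and `mfderiv` is the tangent map. Smooth means `C^∞`. -/

section Manifolds

variable {m n : ℕ}
  {M : Type*} [TopologicalSpace M] [ChartedSpace (EuclideanSpace ℝ (Fin m)) M]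
  {Q : Type*} [TopologicalSpace Q] [ChartedSpace (EuclideanSpace ℝ (Fin n)) Q]

/-- A smooth map with surjective differentials. -/
structure IsSmoothSubmersion (f : M → Q) : Prop where
  contMDiff : ContMDiff (𝓡 m) (𝓡 n) ∞ f
  surjective : ∀ x, Function.Surjective (mfderiv (𝓡 m) (𝓡 n) f x)

/-- A smooth immersion which is a homeomorphism onto its image: its image is an embedded
submanifold, with tangent space at `f x` the range of the differential of `f` at `x`. -/
structure IsSubmanifoldEmbedding (f : M → Q) : Prop where
  contMDiff : ContMDiff (𝓡 m) (𝓡 n) ∞ f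
  injective : ∀ x, Function.Injective (mfderiv (𝓡 m) (𝓡 n) f x)
  isEmbedding : IsEmbedding f

/-- `F` is a smooth rank `k` subbundle of the pullback bundle `f^*(TQ)`: it is spanned, locally, by
`k` pointwise linearly independent smooth sections of `f^*(TQ)`, i.e. smooth vector fields
along `f`. -/
def IsSubbundleAlong [IsManifold (𝓡 n) ∞ Q] (f : M → Q)
    (F : ∀ x : M, Submodule ℝ (TangentSpace (𝓡 n) (f x))) (k : ℕ) : Prop :=
  ∀ x₀ : M, ∃ U : Set M, IsOpen U ∧ x₀ ∈ U ∧
    ∃ s : Fin k → ∀ x : M, TangentSpace (𝓡 n) (f x),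
      (∀ i, ContMDiffOn (𝓡 m) (𝓡 n).tangent ∞
        (fun x => (⟨f x, s i x⟩ : TangentBundle (𝓡 n) Q)) U) ∧
      ∀ x ∈ U, LinearIndependent ℝ (fun i => s i x) ∧
        Submodule.span ℝ (Set.range fun i => s i x) = F x

/-- `F` is a smooth distribution of rank `k` on `Q`, i.e. a subbundle of `TQ`. -/
def IsDistribution [IsManifold (𝓡 n) ∞ Q]
    (F : ∀ q : Q, Submodule ℝ (TangentSpace (𝓡 n) q)) (k : ℕ) : Prop :=
  IsSubbundleAlong (m := n) (fun q : Q => q) F k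

/-- The bracket of two (local) smooth vector fields with values in `F` has values in `F`. -/
def IsInvolutive [IsManifold (𝓡 n) ∞ Q]
    (F : ∀ q : Q, Submodule ℝ (TangentSpace (𝓡 n) q)) : Prop :=
  ∀ U : Set Q, IsOpen U → ∀ X Y : ∀ q : Q, TangentSpace (𝓡 n) q,
    ContMDiffOn (𝓡 n) (𝓡 n).tangent ∞ (fun q => (⟨q, X q⟩ : TangentBundle (𝓡 n) Q)) U →
    ContMDiffOn (𝓡 n) (𝓡 n).tangent ∞ (fun q => (⟨q, Y q⟩ : TangentBundle (𝓡 n) Q)) U →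
    (∀ q ∈ U, X q ∈ F q) → (∀ q ∈ U, Y q ∈ F q) →
    ∀ q ∈ U, VectorField.mlieBracket (𝓡 n) X Y q ∈ F q

/-- There is a smooth curve `c : [a, b] → Q` from `q` to `q'` with `c'(t) ∈ F` for all `t`. -/
def SmoothlyReachable (F : ∀ q : Q, Submodule ℝ (TangentSpace (𝓡 n) q)) (q q' : Q) : Prop :=
  ∃ (a b : ℝ) (c : ℝ → Q), a < b ∧ ContMDiffOn 𝓘(ℝ, ℝ) (𝓡 n) ∞ c (Icc a b) ∧
    (∀ t ∈ Icc a b, mfderivWithin 𝓘(ℝ, ℝ) (𝓡 n) c (Icc a b) t (1 : ℝ) ∈ F (c t)) ∧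
    c a = q ∧ c b = q'

/-- `q'` is `F`-reachable from `q`: a piecewise smooth curve tangent to `F`, i.e. a finite
concatenation of smooth ones, leads from `q` to `q'`. -/
def Reachable (F : ∀ q : Q, Submodule ℝ (TangentSpace (𝓡 n) q)) : Q → Q → Prop :=
  Relation.ReflTransGen (SmoothlyReachable F)

/-- The local vector field near `q` that extends `a ∈ T_qQ` and is constant in the chart at `q`. -/
def extendVector (q : Q) (a : TangentSpace (𝓡 n) q) (y : Q) : TangentSpace (𝓡 n) y :=
  mfderiv 𝓘(ℝ, EuclideanSpace ℝ (Fin n)) (𝓡 n) (extChartAt (𝓡 n) q).symm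
    (extChartAt (𝓡 n) q y)
    (mfderiv (𝓡 n) 𝓘(ℝ, EuclideanSpace ℝ (Fin n)) (extChartAt (𝓡 n) q) q a)

/-! ### One-forms and their exterior derivatives -/

/-- A (not necessarily smooth) one-form on `M`. -/
abbrev OneForm (m : ℕ) (M : Type*) [TopologicalSpace M]
    [ChartedSpace (EuclideanSpace ℝ (Fin m)) M] :=
  ∀ x : M, TangentSpace (𝓡 m) x →L[ℝ] ℝ

/-- A one-form is smooth if it is smooth as a (fibrewise linear) function on the tangent bundle. -/
def OneForm.IsSmooth [IsManifold (𝓡 m) ∞ M] (θ : OneForm m M) : Prop :=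
  ContMDiff (𝓡 m).tangent 𝓘(ℝ, ℝ) ∞ (fun w : TangentBundle (𝓡 m) M => θ w.proj w.snd)

/-- The expression of `θ` in the chart `φ` at `x₀`, i.e. the one-form `(φ⁻¹)^*θ`. -/
def OneForm.inChart (θ : OneForm m M) (x₀ : M) (y : EuclideanSpace ℝ (Fin m)) :
    EuclideanSpace ℝ (Fin m) →L[ℝ] ℝ :=
  (θ ((extChartAt (𝓡 m) x₀).symm y)).comp
    (mfderiv 𝓘(ℝ, EuclideanSpace ℝ (Fin m)) (𝓡 m) (extChartAt (𝓡 m) x₀).symm y)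

/-- The exterior derivative `dθ(x)(a, b)`, computed in the chart at `x` by
`dϑ(a, b) = (D_a ϑ)(b) - (D_b ϑ)(a)`. -/
def OneForm.d (θ : OneForm m M) (x : M) (a b : TangentSpace (𝓡 m) x) : ℝ :=
  let φ := extChartAt (𝓡 m) x
  let a' : EuclideanSpace ℝ (Fin m) := mfderiv (𝓡 m) 𝓘(ℝ, EuclideanSpace ℝ (Fin m)) φ x a
  let b' : EuclideanSpace ℝ (Fin m) := mfderiv (𝓡 m) 𝓘(ℝ, EuclideanSpace ℝ (Fin m)) φ x b
  fderiv ℝ (θ.inChart x) (φ x) a' b' - fderiv ℝ (θ.inChart x) (φ x) b' a'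

end Manifolds

/-! ### Discrete tangent bundles -/

section Discrete

variable (n : ℕ) (V Q : Type*)
  [TopologicalSpace V] [ChartedSpace (EuclideanSpace ℝ (Fin (2 * n))) V]
  [TopologicalSpace Q] [ChartedSpace (EuclideanSpace ℝ (Fin n)) Q]

/-- A discrete tangent bundle `(V, ∂⁺, ∂⁻)` of the `n`-dimensional manifold `Q`. -/
structure DiscreteTangentBundle where
  /-- the boundary map `∂⁺` -/
  plus : V → Q
  /-- the boundary map `∂⁻` -/
  minus : V → Q
  submersion_plus : IsSmoothSubmersion (m := 2 * n) (n := n) plus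
  submersion_minus : IsSmoothSubmersion (m := 2 * n) (n := n) minus
  ker_inf_ker : ∀ v (δv : TangentSpace (𝓡 (2 * n)) v),
    mfderiv (𝓡 (2 * n)) (𝓡 n) plus v δv = 0 →
    mfderiv (𝓡 (2 * n)) (𝓡 n) minus v δv = 0 → δv = 0
  existsUnique_zero : ∀ q : Q, ∃! v : V, plus v = q ∧ minus v = q

namespace DiscreteTangentBundle

variable {n V Q}
variable (B : DiscreteTangentBundle n V Q)

/-- `T_v∂⁺` -/
def Tplus (v : V) : TangentSpace (𝓡 (2 * n)) v →L[ℝ] TangentSpace (𝓡 n) (B.plus v) :=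
  mfderiv (𝓡 (2 * n)) (𝓡 n) B.plus v

/-- `T_v∂⁻` -/
def Tminus (v : V) : TangentSpace (𝓡 (2 * n)) v →L[ℝ] TangentSpace (𝓡 n) (B.minus v) :=
  mfderiv (𝓡 (2 * n)) (𝓡 n) B.minus v

/-- `vert⁺_v = ker T_v∂⁺` -/
def vertPlus (v : V) : Submodule ℝ (TangentSpace (𝓡 (2 * n)) v) :=
  LinearMap.ker (B.Tplus v).toLinearMap

/-- `vert⁻_v = ker T_v∂⁻` -/
def vertMinus (v : V) : Submodule ℝ (TangentSpace (𝓡 (2 * n)) v) :=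
  LinearMap.ker (B.Tminus v).toLinearMap

/-- The tangent map `(T_v∂⁺, T_v∂⁻)` of `∂^± = (∂⁺, ∂⁻)`. -/
def Tboth (v : V) : TangentSpace (𝓡 (2 * n)) v →L[ℝ]
    TangentSpace (𝓡 n) (B.plus v) × TangentSpace (𝓡 n) (B.minus v) :=
  (B.Tplus v).prod (B.Tminus v)

/-- The tangent map of `∂^±` is a linear isomorphism. -/
theorem Tboth_isInvertible (v : V) : (B.Tboth v).IsInvertible := by
  have hinj : Function.Injective (B.Tboth v).toLinearMap := by
    rw [← LinearMap.ker_eq_bot, LinearMap.ker_eq_bot']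
    intro w hw
    exact B.ker_inf_ker v w (congrArg Prod.fst hw) (congrArg Prod.snd hw)
  let L : EuclideanSpace ℝ (Fin (2 * n)) →ₗ[ℝ]
      EuclideanSpace ℝ (Fin n) × EuclideanSpace ℝ (Fin n) := (B.Tboth v).toLinearMap
  have hfin : Module.finrank ℝ (EuclideanSpace ℝ (Fin (2 * n))) =
      Module.finrank ℝ (EuclideanSpace ℝ (Fin n) × EuclideanSpace ℝ (Fin n)) := by
    simp [Module.finrank_prod]; ring
  let e := (LinearEquiv.ofInjectiveOfFinrankEq L hinj hfin).toContinuousLinearEquiv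
  exact ⟨e, rfl⟩

/-- `δq⁺`: the unique `δv ∈ vert⁻_v` with `T∂⁺(δv) = δq`. -/
def liftPlus (v : V) : TangentSpace (𝓡 n) (B.plus v) →L[ℝ] TangentSpace (𝓡 (2 * n)) v :=
  (B.Tboth v).inverse.comp (ContinuousLinearMap.inl ℝ _ _)

/-- `δq⁻`: the unique `δv ∈ vert⁺_v` with `T∂⁻(δv) = δq`. -/
def liftMinus (v : V) : TangentSpace (𝓡 n) (B.minus v) →L[ℝ] TangentSpace (𝓡 (2 * n)) v :=
  (B.Tboth v).inverse.comp (ContinuousLinearMap.inr ℝ _ _)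

theorem Tboth_inverse_apply (v : V)
    (w : TangentSpace (𝓡 n) (B.plus v) × TangentSpace (𝓡 n) (B.minus v)) :
    B.Tboth v ((B.Tboth v).inverse w) = w := by
  obtain ⟨e, he⟩ := B.Tboth_isInvertible v
  rw [← he, ContinuousLinearMap.inverse_equiv]
  exact e.apply_symm_apply w

theorem Tplus_liftPlus (v : V) (a) : B.Tplus v (B.liftPlus v a) = a :=
  congrArg Prod.fst (B.Tboth_inverse_apply v (a, 0))

theorem Tminus_liftPlus (v : V) (a) : B.Tminus v (B.liftPlus v a) = 0 :=
  congrArg Prod.snd (B.Tboth_inverse_apply v (a, 0))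

theorem Tplus_liftMinus (v : V) (a) : B.Tplus v (B.liftMinus v a) = 0 :=
  congrArg Prod.fst (B.Tboth_inverse_apply v (0, a))

theorem Tminus_liftMinus (v : V) (a) : B.Tminus v (B.liftMinus v a) = a :=
  congrArg Prod.snd (B.Tboth_inverse_apply v (0, a))

/-- The bilinear form `d^±θ(v)(δq, δq')`, for `δq ∈ T_{∂⁻(v)}Q` and `δq' ∈ T_{∂⁺(v)}Q`: the
derivative at `v`, in the direction of the vector `δq'⁺ ∈ vert⁻_v`, of the function `θ(X)`, where
`X` is the local vector field with values in `vert⁺` that lifts, through `∂⁻`, a local vector field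
on `Q` extending `δq`. (The value does not depend on this extension, as `∂⁻` is
constant to first order in the direction `δq'⁺`; the one that is constant in a chart is used.) -/
def dpm (θ : OneForm (2 * n) V) (v : V) (δq : TangentSpace (𝓡 n) (B.minus v))
    (δq' : TangentSpace (𝓡 n) (B.plus v)) : ℝ :=
  mfderiv (𝓡 (2 * n)) 𝓘(ℝ, ℝ)
    (fun x : V => θ x (B.liftMinus x (extendVector (n := n) (B.minus v) δq (B.minus x)))) v
    (B.liftPlus v δq')

/-- `θ⁺_σ(v)δv = σ(v)δv⁺`, where `δv⁺ = (T∂⁺ δv)⁺` is the `vert⁻_v` part of `δv`. -/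
def thetaPlus (σ : OneForm (2 * n) V) : OneForm (2 * n) V :=
  fun v => (σ v).comp ((B.liftPlus v).comp (B.Tplus v))

/-- `θ⁻_σ(v)δv = -σ(v)δv⁻`, where `δv⁻ = (T∂⁻ δv)⁻` is the `vert⁺_v` part of `δv`. -/
def thetaMinus (σ : OneForm (2 * n) V) : OneForm (2 * n) V :=
  fun v => -(σ v).comp ((B.liftMinus v).comp (B.Tminus v))

/-- The discrete two-form `ω⁺_σ = -dθ⁺_σ`. -/
def omegaPlus (σ : OneForm (2 * n) V) (v : V) (δv δw : TangentSpace (𝓡 (2 * n)) v) : ℝ :=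
  -(OneForm.d (B.thetaPlus σ) v δv δw)

/-- The discrete two-form `ω⁻_σ = -dθ⁻_σ`. -/
def omegaMinus (σ : OneForm (2 * n) V) (v : V) (δv δw : TangentSpace (𝓡 (2 * n)) v) : ℝ :=
  -(OneForm.d (B.thetaMinus σ) v δv δw)

end DiscreteTangentBundle

/-! ### Discrete constrained Lagrangian systems -/

variable (k : ℕ) (D : Type*) [TopologicalSpace D] [ChartedSpace (EuclideanSpace ℝ (Fin k)) D]
variable [IsManifold (𝓡 (2 * n)) ∞ V] [IsManifold (𝓡 n) ∞ Q]

/-- A discrete constrained Lagrangian system `(V, ∂⁺, ∂⁻, σ, 𝒟, ℰ)`. The `k`-dimensional submanifold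
`𝒟` of `V` is the image of the embedding `incl` of a `k`-dimensional manifold `D`; a point of `𝒟`
is `incl x` for a unique `x : D`, and `T_{incl x}𝒟` is the range of `T_x incl`. -/
structure DCLS extends DiscreteTangentBundle n V Q where
  /-- the one-form `σ`, the analogue of the differential of a discrete Lagrangian -/
  σ : OneForm (2 * n) V
  smooth_σ : σ.IsSmooth
  /-- the inclusion of the constraint submanifold -/
  incl : D → V
  embedding_incl : IsSubmanifoldEmbedding (m := k) (n := 2 * n) incl
  submersion_plus_incl : IsSmoothSubmersion (m := k) (n := n) (plus ∘ incl)
  submersion_minus_incl : IsSmoothSubmersion (m := k) (n := n) (minus ∘ incl)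
  /-- the fibre dimension of `ℰ` -/
  fdimE : ℕ
  /-- the subbundle `ℰ` of `(∂⁺|𝒟)^*(TQ)` -/
  E : ∀ x : D, Submodule ℝ (TangentSpace (𝓡 n) (plus (incl x)))
  subbundle_E : IsSubbundleAlong (m := k) (n := n) (fun x : D => plus (incl x)) E fdimE

namespace DCLS

variable {n V Q k D}
variable (C : DCLS n V Q k D)

/-- The tangent space `T_v𝒟` at `v = incl x`. -/
def tangentD (x : D) : Submodule ℝ (TangentSpace (𝓡 (2 * n)) (C.incl x)) :=
  LinearMap.range (mfderiv (𝓡 k) (𝓡 (2 * n)) C.incl x).toLinearMap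

/-- Regularity⁻: for all `v, ṽ ∈ 𝒟` with `∂⁺(v) = ∂⁻(ṽ)` and all
`δq ∈ T∂⁻(vert⁺_ṽ ∩ T_ṽ𝒟)`, if `d^±σ(ṽ)(δq, δq') = 0` for all `δq' ∈ ℰ_ṽ`, then `δq = 0`. -/
def RegularMinus : Prop :=
  ∀ x x' : D, C.plus (C.incl x) = C.minus (C.incl x') →
    ∀ δq ∈ (C.vertPlus (C.incl x') ⊓ C.tangentD x').map (C.Tminus (C.incl x')).toLinearMap,
      (∀ δq' ∈ C.E x', C.dpm C.σ (C.incl x') δq δq' = 0) → δq = 0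

/-- Regularity⁺: for all `v, ṽ ∈ 𝒟` with `∂⁺(v) = ∂⁻(ṽ)` and all
`δq' ∈ T∂⁺(vert⁻_ṽ ∩ T_ṽ𝒟)`, if `d^±σ(ṽ)(δq, δq') = 0` for all `δq ∈ ℰ_v`, then `δq' = 0`. -/
def RegularPlus : Prop :=
  ∀ (x x' : D) (h : C.plus (C.incl x) = C.minus (C.incl x')),
    ∀ δq' ∈ (C.vertMinus (C.incl x') ⊓ C.tangentD x').map (C.Tplus (C.incl x')).toLinearMap,
      (∀ δq ∈ C.E x, C.dpm C.σ (C.incl x') (h ▸ δq) δq' = 0) → δq' = 0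

/-- `σ` is regular if it is regular⁻ and regular⁺. -/
def Regular : Prop := C.RegularMinus ∧ C.RegularPlus

/-- The system has linear constraints, with the rank `r` distribution `F` on `Q`. The manifold `F`
(a vector bundle over `Q`) has dimension `n + r`. -/
structure HasLinearConstraints (F : ∀ q : Q, Submodule ℝ (TangentSpace (𝓡 n) q)) (r : ℕ) :
    Prop where
  distribution : IsDistribution F r
  E_eq : ∀ x : D, C.E x = F (C.plus (C.incl x))
  reachable : ∀ x : D, Reachable F (C.minus (C.incl x)) (C.plus (C.incl x))
  dim_eq : k = n + r

/-- The system is holonomic: it has linear constraints with an involutive distribution `F`, and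
`σ` is closed. -/
structure IsHolonomic (F : ∀ q : Q, Submodule ℝ (TangentSpace (𝓡 n) q)) (r : ℕ) : Prop
    extends C.HasLinearConstraints F r where
  involutive : IsInvolutive F
  closed : ∀ (v : V) (a b : TangentSpace (𝓡 (2 * n)) v), C.σ.d v a b = 0

/-- The fibre at `v` of `𝒦⁰ = (T∂⁻)⁻¹F ∩ (T∂⁺)⁻¹F`. -/
def K0 (F : ∀ q : Q, Submodule ℝ (TangentSpace (𝓡 n) q)) (v : V) :
    Submodule ℝ (TangentSpace (𝓡 (2 * n)) v) :=
  (F (C.minus v)).comap (C.Tminus v).toLinearMap ⊓ (F (C.plus v)).comap (C.Tplus v).toLinearMap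

/-- The two-form `w` on `V` is nondegenerate on the restriction of `𝒦⁰` to `𝒟`. -/
def NondegenerateOnK0 (F : ∀ q : Q, Submodule ℝ (TangentSpace (𝓡 n) q))
    (w : ∀ v : V, TangentSpace (𝓡 (2 * n)) v → TangentSpace (𝓡 (2 * n)) v → ℝ) : Prop :=
  ∀ x : D, ∀ δv ∈ C.K0 F (C.incl x),
    (∀ δw ∈ C.K0 F (C.incl x), w (C.incl x) δv δw = 0) → δv = 0

end DCLS
end Discrete
end DiscreteMechanics
end

/-!
By Frobenius, an involutive distribution `F` has a foliation box around every point: a chart whose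
last coordinates are constant along curves tangent to `F`. Hence the points reachable from `q` by
curves tangent to `F` meet each box in countably many plaques, and a smooth curve of reachable
points has constant last coordinates, that is, it is tangent to `F`. Applied to the `∂⁺`-fibres
inside `𝒟`, this gives `T∂⁻(vert⁺ ∩ T𝒟) ⊆ F`, with equality since `dim 𝒟 = n + r`; the same holds
with the signs exchanged. The linear constraints thus make both tests in `Regular` tests on `F`:
`d^±σ` has neither a left nor a right kernel on `F × F`.

Since `σ = θ⁺ - θ⁻`, closedness of `σ` gives `ω⁺ = ω⁻`. The form `ω⁺` vanishes on pairs in `vert⁺`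
and `ω⁻` on pairs in `vert⁻`, so `ω(a, b) = d^±σ(T∂⁻ b, T∂⁺ a) - d^±σ(T∂⁻ a, T∂⁺ b)`. On
`𝒦⁰ = F⁻ ⊕ F⁺`, the sum of the two lifts of `F`, such a form is nondegenerate exactly when `d^±σ`
has no left and no right kernel.
-/

noncomputable section

namespace DiscreteMechanics

/-! ### Integral curves -/

section IntegralCurves

open Metric
open scoped NNReal

variable {E : Type*} [NormedAddCommGroup E] [NormedSpace ℝ E]

theorem exists_isIntegralCurveOn_mapsTo_closedBall [CompleteSpace E] {f : E → E} {p : E} {L K : ℝ≥0}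
    (hlip : LipschitzOnWith K f (closedBall p L)) (hnorm : ∀ z ∈ closedBall p L, ‖f z‖ ≤ L) :
    ∃ α : ℝ → E, α 0 = p ∧ IsIntegralCurveOn α (fun _ => f) (Icc 0 1) ∧
      MapsTo α (Icc 0 1) (closedBall p L) := by
  -- Cutting `f` off outside the ball makes the bound on the speed hold a priori.
  set g : E → E := (closedBall p L).indicator f with hg
  have hgf : EqOn g f (closedBall p L) := eqOn_indicator
  have hgL (z : E) : ‖g z‖ ≤ L := by
    by_cases hz : z ∈ closedBall p L
    · exact (hgf hz).symm ▸ hnorm z hz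
    · simp [hg, hz]
  have hglip : LipschitzOnWith K g (closedBall p L) := fun x hx y hy => by
    rw [hgf hx, hgf hy]
    exact hlip hx hy
  obtain ⟨α, h0, hα⟩ := (IsPicardLindelof.of_time_independent (f := g) (tmin := 0) (tmax := 1)
    (t₀ := ⟨0, by simp⟩) (a := L) (r := 0) (fun z _ => hgL z) hglip
    (by simp)).exists_eq_forall_mem_Icc_hasDerivWithinAt₀
  change α 0 = p at h0
  have hball : MapsTo α (Icc 0 1) (closedBall p L) := fun t ht => by
    have hle := norm_image_sub_le_of_norm_deriv_le_segment' hα (fun t _ => hgL (α t)) t ht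
    rw [h0, sub_zero] at hle
    exact mem_closedBall_iff_norm.2 (hle.trans (mul_le_of_le_one_right L.2 ht.2))
  exact ⟨α, h0, fun t ht => (hα t ht).congr_deriv (hgf (hball ht)), hball⟩

theorem eq_of_hasDerivWithinAt_zero {f : ℝ → E} {J : Set ℝ} (hJ : Convex ℝ J)
    (hf : ∀ t ∈ J, HasDerivWithinAt f 0 J t) {a b : ℝ} (ha : a ∈ J) (hb : b ∈ J) : f a = f b := by
  have hle := hJ.norm_image_sub_le_of_norm_hasDerivWithin_le (C := 0) hf (by simp) hb ha
  rwa [zero_mul, norm_le_zero_iff, sub_eq_zero] at hle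

theorem gronwallBound_one_le {δ K ε : ℝ} (hK : 0 < K) (hε : 0 ≤ ε) :
    gronwallBound δ K ε 1 ≤ Real.exp K * (δ + ε) := by
  have hexp : Real.exp K - 1 ≤ K * Real.exp K := by
    have h := mul_le_mul_of_nonneg_left (Real.add_one_le_exp (-K)) (Real.exp_pos K).le
    rw [← Real.exp_add, add_neg_cancel, Real.exp_zero] at h
    linarith
  calc gronwallBound δ K ε 1 = δ * Real.exp K + ε / K * (Real.exp K - 1) := by
        rw [gronwallBound_of_K_ne_0 hK.ne']; simp only [mul_one]
    _ ≤ δ * Real.exp K + ε / K * (K * Real.exp K) := by gcongr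
    _ = Real.exp K * (δ + ε) := by field_simp

end IntegralCurves

/-! ### Commuting frames and their first integrals -/

section CommutingFrames

open Metric
open scoped NNReal

variable {E W : Type*} [NormedAddCommGroup E] [NormedSpace ℝ E]
  [NormedAddCommGroup W] [NormedSpace ℝ W]

/-- A commuting frame on the convex set `Ω`: the vector fields `z ↦ S z a`, for `a : W`, commute,
and the linear map `T` projects them to the constant vector fields `a`, so that they are pointwise
linearly independent. The constant `K` bounds `S`, its derivative and the Lipschitz constant of the
latter. -/
structure IsCommutingFrame (S : E → W →L[ℝ] E) (T : E →L[ℝ] W) (Ω : Set E) (K : ℝ≥0) :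
    Prop where
  convex : Convex ℝ Ω
  one_le : 1 ≤ K
  differentiableAt : ∀ z ∈ Ω, DifferentiableAt ℝ S z
  norm_le : ∀ z ∈ Ω, ‖S z‖ ≤ K
  norm_fderiv_le : ∀ z ∈ Ω, ‖fderiv ℝ S z‖ ≤ K
  lipschitzOnWith_fderiv : LipschitzOnWith K (fderiv ℝ S) Ω
  comm : ∀ z ∈ Ω, ∀ a b, fderiv ℝ S z (S z a) b = fderiv ℝ S z (S z b) a
  proj : ∀ z ∈ Ω, ∀ a, T (S z a) = a

/-- `α : [0, 1] → Ω` is an integral curve of the vector field `z ↦ S z a`. -/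
structure IsTrajectory (S : E → W →L[ℝ] E) (Ω : Set E) (a : W) (α : ℝ → E) : Prop where
  isIntegralCurveOn : IsIntegralCurveOn α (fun _ z => S z a) (Icc 0 1)
  mapsTo : MapsTo α (Icc 0 1) Ω

theorem IsTrajectory.mono {S : E → W →L[ℝ] E} {Ω Ω' : Set E} {a : W} {α : ℝ → E}
    (hα : IsTrajectory S Ω a α) (h : Ω ⊆ Ω') : IsTrajectory S Ω' a α :=
  ⟨hα.isIntegralCurveOn, hα.mapsTo.mono_right h⟩

theorem hasDerivWithinAt_Ici_of_Icc {f : ℝ → E} {f' : E} {t : ℝ}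
    (hf : HasDerivWithinAt f f' (Icc 0 1) t) (ht : t ∈ Ico (0 : ℝ) 1) :
    HasDerivWithinAt f f' (Ici t) t :=
  hf.mono_of_mem_nhdsWithin (Icc_mem_nhdsGE_of_mem ht)

namespace IsCommutingFrame

variable {S : E → W →L[ℝ] E} {T : E →L[ℝ] W} {Ω : Set E} {K : ℝ≥0} {a b : W} {α β : ℝ → E}

theorem lipschitzOnWith (H : IsCommutingFrame S T Ω K) : LipschitzOnWith K S Ω :=
  H.convex.lipschitzOnWith_of_nnnorm_fderiv_le H.differentiableAt H.norm_fderiv_le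

theorem lipschitzOnWith_apply (H : IsCommutingFrame S T Ω K) (a : W) :
    LipschitzOnWith (K * ‖a‖₊) (fun z => S z a) Ω :=
  LipschitzOnWith.of_dist_le_mul fun z hz w hw => by
    rw [dist_eq_norm, dist_eq_norm, ← sub_apply, NNReal.coe_mul, coe_nnnorm, mul_right_comm]
    exact ContinuousLinearMap.le_of_opNorm_le _ (H.lipschitzOnWith.norm_sub_le hz hw) a

theorem norm_sub_sub_fderiv_le (H : IsCommutingFrame S T Ω K) {z w : E} (hz : z ∈ Ω)
    (hw : w ∈ Ω) : ‖S w - S z - fderiv ℝ S z (w - z)‖ ≤ K * ‖w - z‖ ^ 2 := by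
  have hseg : segment ℝ z w ⊆ Ω := H.convex.segment_subset hz hw
  have hbound : ∀ x ∈ segment ℝ z w, ‖fderiv ℝ S x - fderiv ℝ S z‖ ≤ K * ‖w - z‖ := fun x hx =>
    (H.lipschitzOnWith_fderiv.norm_sub_le (hseg hx) hz).trans
      (mul_le_mul_of_nonneg_left (norm_sub_le_of_mem_segment hx) K.2)
  have h := (convex_segment z w).norm_image_sub_le_of_norm_hasFDerivWithin_le'
    (fun x hx => (H.differentiableAt x (hseg hx)).hasFDerivAt.hasFDerivWithinAt) hbound
    (left_mem_segment ℝ z w) (right_mem_segment ℝ z w)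
  rwa [mul_assoc, ← sq] at h

theorem exists_trajectory [CompleteSpace E] (H : IsCommutingFrame S T Ω K) {p : E}
    (hp : closedBall p (K * ‖a‖) ⊆ Ω) :
    ∃ α, α 0 = p ∧ IsTrajectory S (closedBall p (K * ‖a‖)) a α := by
  obtain ⟨α, h0, hα, hball⟩ := exists_isIntegralCurveOn_mapsTo_closedBall (L := K * ‖a‖₊)
    ((H.lipschitzOnWith_apply a).mono hp)
    (fun z hz => ContinuousLinearMap.le_of_opNorm_le _ (H.norm_le z (hp hz)) a)
  exact ⟨α, h0, hα, hball⟩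

theorem proj_trajectory (H : IsCommutingFrame S T Ω K) (hα : IsTrajectory S Ω a α) :
    T (α 1) = T (α 0) + a := by
  have hd : ∀ t ∈ Icc (0 : ℝ) 1, HasDerivWithinAt (fun t => T (α t) - t • a) 0 (Icc 0 1) t := by
    intro t ht
    have hT := T.hasFDerivAt.comp_hasDerivWithinAt t (hα.isIntegralCurveOn t ht)
    rw [H.proj _ (hα.mapsTo ht)] at hT
    have h := hT.sub ((hasDerivAt_id t).smul_const a).hasDerivWithinAt
    rwa [one_smul, sub_self] at h
  have h := eq_of_hasDerivWithinAt_zero (convex_Icc 0 1) hd (a := 1) (b := 0) (by simp)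
    (by simp)
  simpa [sub_eq_iff_eq_add] using h

theorem trajectory_zero_eq_of_one_eq (H : IsCommutingFrame S T Ω K) (hα : IsTrajectory S Ω a α)
    (hβ : IsTrajectory S Ω a β) (h : α 1 = β 1) : α 0 = β 0 := by
  have hIic {γ : ℝ → E} (hγ : IsTrajectory S Ω a γ) (t : ℝ) (ht : t ∈ Ioc (0 : ℝ) 1) :
      HasDerivWithinAt γ (S (γ t) a) (Iic t) t :=
    (hγ.isIntegralCurveOn t (Ioc_subset_Icc_self ht)).mono_of_mem_nhdsWithin
      (Icc_mem_nhdsLE_of_mem ht)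
  exact ODE_solution_unique_of_mem_Icc_left (v := fun _ z => S z a) (s := fun _ => Ω)
    (fun _ _ => H.lipschitzOnWith_apply a) hα.isIntegralCurveOn.continuousOn (hIic hα)
    (fun _ ht => hα.mapsTo (Ioc_subset_Icc_self ht)) hβ.isIntegralCurveOn.continuousOn (hIic hβ)
    (fun _ ht => hβ.mapsTo (Ioc_subset_Icc_self ht)) h (by simp)

theorem norm_displacement_sub_le (H : IsCommutingFrame S T Ω K) {p : E}
    (hp : closedBall p (K * ‖a‖) ⊆ Ω) (hα : IsTrajectory S (closedBall p (K * ‖a‖)) a α)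
    (h0 : α 0 = p) : ‖α 1 - p - S p a‖ ≤ K ^ 2 * ‖a‖ ^ 2 := by
  have hd (t : ℝ) (ht : t ∈ Icc (0 : ℝ) 1) :
      HasDerivWithinAt (fun t => α t - t • S p a) (S (α t) a - S p a) (Icc 0 1) t := by
    have h := (hα.isIntegralCurveOn t ht).sub
      ((hasDerivAt_id t).smul_const (S p a)).hasDerivWithinAt
    rwa [one_smul] at h
  have hbound (t : ℝ) (ht : t ∈ Ico (0 : ℝ) 1) : ‖S (α t) a - S p a‖ ≤ K ^ 2 * ‖a‖ ^ 2 := by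
    have hball := hα.mapsTo (Ico_subset_Icc_self ht)
    calc ‖S (α t) a - S p a‖ ≤ K * ‖a‖ * ‖α t - p‖ :=
          (H.lipschitzOnWith_apply a).norm_sub_le (hp hball)
            (hp (mem_closedBall_self (by positivity)))
      _ ≤ K * ‖a‖ * (K * ‖a‖) := by gcongr; exact mem_closedBall_iff_norm.1 hball
      _ = K ^ 2 * ‖a‖ ^ 2 := by ring
  have h := norm_image_sub_le_of_norm_deriv_le_segment' hd hbound 1 (by simp)
  simpa [h0, sub_right_comm] using h

/-- The curve `α` of velocity `S (α t) a`, corrected to first order so as to start at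
`α 0 + S (α 0) b` and to have velocity close to `S (α t) (a - b)`, with the same endpoint. -/
def shiftedCurve (S : E → W →L[ℝ] E) (b : W) (α : ℝ → E) (t : ℝ) : E :=
  α t + (1 - t) • S (α t) b

theorem hasDerivWithinAt_shiftedCurve (H : IsCommutingFrame S T Ω K) (hα : IsTrajectory S Ω a α)
    (b : W) {t : ℝ} (ht : t ∈ Icc (0 : ℝ) 1) :
    HasDerivWithinAt (shiftedCurve S b α)
      (S (α t) a + ((1 - t) • fderiv ℝ S (α t) (S (α t) a) b - S (α t) b)) (Icc 0 1) t := by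
  have hd := hα.isIntegralCurveOn t ht
  have hS := ((H.differentiableAt _ (hα.mapsTo ht)).hasFDerivAt.comp_hasDerivWithinAt t hd
    ).clm_apply (hasDerivWithinAt_const t (Icc 0 1) b)
  convert! hd.add (((hasDerivAt_id t).const_sub 1).hasDerivWithinAt.smul hS) using 1
  simp [sub_eq_add_neg]

theorem norm_velocity_shiftedCurve_sub_le (H : IsCommutingFrame S T Ω K) (hab : ‖a - b‖ ≤ 1)
    (hα : IsTrajectory S Ω a α) {t : ℝ} (ht : t ∈ Icc (0 : ℝ) 1)
    (hη : shiftedCurve S b α t ∈ Ω) :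
    ‖S (α t) a + ((1 - t) • fderiv ℝ S (α t) (S (α t) a) b - S (α t) b) -
      S (shiftedCurve S b α t) (a - b)‖ ≤ 2 * K ^ 3 * ‖b‖ ^ 2 := by
  have hz : α t ∈ Ω := hα.mapsTo ht
  have ht0 : 0 ≤ 1 - t := sub_nonneg.2 ht.2
  have ht1 : 1 - t ≤ 1 := sub_le_self _ ht.1
  have hK : (1 : ℝ) ≤ K := H.one_le
  set u := S (α t) b with hu
  have hu_le : ‖u‖ ≤ K * ‖b‖ := ContinuousLinearMap.le_of_opNorm_le _ (H.norm_le _ hz) b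
  have hshift : shiftedCurve S b α t - α t = (1 - t) • u := add_sub_cancel_left _ _
  have htu : ‖(1 - t) • u‖ ≤ K * ‖b‖ := by
    rw [norm_smul, Real.norm_of_nonneg ht0]
    exact (mul_le_of_le_one_left (norm_nonneg _) ht1).trans hu_le
  set R := S (shiftedCurve S b α t) - S (α t) - fderiv ℝ S (α t) ((1 - t) • u) with hR
  have hR_le : ‖R‖ ≤ K * (K * ‖b‖) ^ 2 := by
    have h := H.norm_sub_sub_fderiv_le hz hη
    rw [hshift] at h
    exact h.trans (by gcongr)
  have hsplit : S (α t) a + ((1 - t) • fderiv ℝ S (α t) (S (α t) a) b - u) -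
      S (shiftedCurve S b α t) (a - b) = fderiv ℝ S (α t) ((1 - t) • u) b - R (a - b) := by
    have hS : S (shiftedCurve S b α t) = S (α t) + fderiv ℝ S (α t) ((1 - t) • u) + R := by
      rw [hR]
      abel
    rw [hS]
    simp only [add_apply, map_smul, smul_apply, map_sub, hu, H.comm _ hz a b]
    abel
  calc _ ≤ ‖fderiv ℝ S (α t) ((1 - t) • u) b‖ + ‖R (a - b)‖ := hsplit ▸ norm_sub_le _ _
    _ ≤ K * (K * ‖b‖) * ‖b‖ + K * (K * ‖b‖) ^ 2 := by
      refine add_le_add (ContinuousLinearMap.le_of_opNorm_le _ ?_ b)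
        ((ContinuousLinearMap.le_of_opNorm_le _ hR_le _).trans
          (mul_le_of_le_one_right (by positivity) hab))
      exact (ContinuousLinearMap.le_of_opNorm_le _ (H.norm_fderiv_le _ hz) _).trans (by gcongr)
    _ = (K ^ 2 + K ^ 3) * ‖b‖ ^ 2 := by ring
    _ ≤ (K ^ 3 + K ^ 3) * ‖b‖ ^ 2 := by
      gcongr
      norm_num
    _ = 2 * K ^ 3 * ‖b‖ ^ 2 := by ring

theorem norm_endpoint_sub_le (H : IsCommutingFrame S T Ω K) (hab : ‖a - b‖ ≤ 1)
    (hα : IsTrajectory S Ω a α) (hη : MapsTo (shiftedCurve S b α) (Icc 0 1) Ω)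
    (hβ : IsTrajectory S Ω (a - b) β) :
    ‖β 1 - α 1‖ ≤ Real.exp K * (‖β 0 - α 0 - S (α 0) b‖ + 2 * K ^ 3 * ‖b‖ ^ 2) := by
  have hη_deriv := fun t ht => H.hasDerivWithinAt_shiftedCurve (t := t) hα b ht
  have hlip : LipschitzOnWith K (fun z => S z (a - b)) Ω :=
    (H.lipschitzOnWith_apply (a - b)).weaken (mul_le_of_le_one_right' hab)
  have hgron := dist_le_of_approx_trajectories_ODE_of_mem (a := 0) (b := 1)
    (v := fun _ z => S z (a - b)) (s := fun _ => Ω) (εf := 0) (εg := 2 * K ^ 3 * ‖b‖ ^ 2)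
    (δ := ‖β 0 - α 0 - S (α 0) b‖) (fun _ _ => hlip)
    hβ.isIntegralCurveOn.continuousOn
    (fun t ht => hasDerivWithinAt_Ici_of_Icc
      (hβ.isIntegralCurveOn t (Ico_subset_Icc_self ht)) ht)
    (fun _ _ => (dist_self _).le) (fun _ ht => hβ.mapsTo (Ico_subset_Icc_self ht))
    (fun t ht => (hη_deriv t ht).continuousWithinAt)
    (fun t ht => hasDerivWithinAt_Ici_of_Icc (hη_deriv t (Ico_subset_Icc_self ht)) ht)
    (fun t ht => (dist_eq_norm _ _).trans_le (H.norm_velocity_shiftedCurve_sub_le hab hα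
      (Ico_subset_Icc_self ht) (hη (Ico_subset_Icc_self ht))))
    (fun _ ht => hη (Ico_subset_Icc_self ht))
    (by simp [dist_eq_norm, shiftedCurve, sub_add_eq_sub_sub]) 1 (by simp)
  rw [dist_eq_norm, zero_add, sub_zero] at hgron
  have hη1 : shiftedCurve S b α 1 = α 1 := by simp [shiftedCurve]
  rw [hη1] at hgron
  exact hgron.trans (gronwallBound_one_le (one_pos.trans_le H.one_le) (by positivity))

end IsCommutingFrame

/-- To first order, `h` does not change in the directions of the frame `S`, `T` on `N`. -/
def IsFirstOrderInvariant {F : Type*} [NormedAddCommGroup F] (S : E → W →L[ℝ] E) (T : E →L[ℝ] W)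
    (h : E → F) (N : Set E) : Prop :=
  ∃ C : ℝ, ∀ p ∈ N, ∀ p' ∈ N,
    ‖h p' - h p‖ ≤ C * (‖p' - p - S p (T (p' - p))‖ + ‖T (p' - p)‖ ^ 2)

theorem IsFirstOrderInvariant.mono {F : Type*} [NormedAddCommGroup F] {S : E → W →L[ℝ] E}
    {T : E →L[ℝ] W} {h : E → F} {N N' : Set E} (hh : IsFirstOrderInvariant S T h N)
    (hN : N' ⊆ N) : IsFirstOrderInvariant S T h N' :=
  hh.imp fun _ hC p hp p' hp' => hC p (hN hp) p' (hN hp')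

theorem IsFirstOrderInvariant.continuousOn {F : Type*} [NormedAddCommGroup F]
    {S : E → W →L[ℝ] E} {T : E →L[ℝ] W} {h : E → F} {N : Set E}
    (hh : IsFirstOrderInvariant S T h N) : ContinuousOn h N := by
  obtain ⟨C, hC⟩ := hh
  intro p hp
  have hcont : Continuous fun p' => C * (‖p' - p - S p (T (p' - p))‖ + ‖T (p' - p)‖ ^ 2) := by
    fun_prop
  have h0 := (hcont.tendsto' p 0 (by simp)).mono_left (nhdsWithin_le_nhds (s := N))
  rw [ContinuousWithinAt, tendsto_iff_norm_sub_tendsto_zero]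
  refine squeeze_zero' (.of_forall fun _ => norm_nonneg _) ?_ h0
  filter_upwards [self_mem_nhdsWithin] with p' hp' using hC p hp p' hp'

theorem IsFirstOrderInvariant.hasDerivWithinAt_zero {F : Type*} [NormedAddCommGroup F]
    [NormedSpace ℝ F] {S : E → W →L[ℝ] E} {T : E →L[ℝ] W} {h : E → F} {N : Set E} {c : ℝ → E}
    {v : E} {s : Set ℝ} {t : ℝ} (hh : IsFirstOrderInvariant S T h N)
    (hc : HasDerivWithinAt c v s t) (hv : S (c t) (T v) = v) (ht : c t ∈ N)
    (hN : ∀ᶠ x in 𝓝[s] t, c x ∈ N) :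
    HasDerivWithinAt (fun x => h (c x)) 0 s t := by
  obtain ⟨C, hC⟩ := hh
  have htransverse : (fun x => ‖c x - c t - S (c t) (T (c x - c t))‖) =o[𝓝[s] t]
      fun x => x - t := by
    have hd := ((ContinuousLinearMap.id ℝ E - (S (c t)).comp T).hasFDerivAt
      (x := c t)).comp_hasDerivWithinAt t hc
    have ho := (hasDerivWithinAt_iff_isLittleO.1 hd).norm_left
    refine ho.congr_left fun x => ?_
    simp only [Function.comp_apply, sub_apply, ContinuousLinearMap.id_apply,
      ContinuousLinearMap.comp_apply, hv, map_sub, sub_self, smul_zero, sub_zero]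
    congr 1
    abel
  have hsquare : (fun x => ‖T (c x - c t)‖ ^ 2) =o[𝓝[s] t] fun x => x - t := by
    have hO := ((T.isBigO_comp _ _).trans hc.hasFDerivWithinAt.isBigO_sub).norm_norm.pow 2
    exact hO.trans_isLittleO
      ((Asymptotics.isLittleO_pow_sub_sub t one_lt_two).mono nhdsWithin_le_nhds)
  rw [hasDerivWithinAt_iff_isLittleO]
  simp only [smul_zero, sub_zero]
  refine Asymptotics.IsBigO.trans_isLittleO (.of_bound' ?_)
    ((htransverse.add hsquare).const_mul_left C)
  filter_upwards [hN] with x hx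
  exact (hC _ ht _ hx).trans (le_abs_self _)

theorem exists_mem_nhds_forall_closedBall_subset {X : Type*} [PseudoMetricSpace X] {Ω : Set X}
    {z : X} (hΩ : Ω ∈ 𝓝 z) {r : X × X → ℝ} (hr : ContinuousAt r (z, z)) (hz : r (z, z) = 0) :
    ∃ N ∈ 𝓝 z, ∀ p ∈ N, ∀ p' ∈ N, closedBall p (r (p, p')) ⊆ Ω := by
  obtain ⟨δ, hδ, hball⟩ := nhds_basis_closedBall.mem_iff.1 hΩ
  have hsum : ∀ᶠ x : X × X in 𝓝 (z, z), r x + dist x.1 z < δ := by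
    have hcont : ContinuousAt (fun x : X × X => r x + dist x.1 z) (z, z) := by fun_prop
    exact hcont.eventually_lt_const (by simpa [hz])
  rw [nhds_prod_eq, Filter.eventually_iff, Filter.mem_prod_self_iff] at hsum
  obtain ⟨N, hN, hsub⟩ := hsum
  exact ⟨N, hN, fun p hp p' hp' =>
    (closedBall_subset_closedBall' (hsub (mk_mem_prod hp hp')).le).trans hball⟩

namespace IsCommutingFrame

variable {S : E → W →L[ℝ] E} {T : E →L[ℝ] W} {Ω : Set E} {K : ℝ≥0} {z₀ : E}

theorem mapsTo_shiftedCurve (H : IsCommutingFrame S T Ω K) {a b : W} {α : ℝ → E} {p : E}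
    (hα : IsTrajectory S (closedBall p (K * ‖a‖)) a α)
    (hp : closedBall p (K * (‖a‖ + ‖b‖)) ⊆ Ω) : MapsTo (shiftedCurve S b α) (Icc 0 1) Ω := by
  intro t ht
  have hball := hα.mapsTo ht
  have hmem : α t ∈ Ω := hp (closedBall_subset_closedBall
    (mul_le_mul_of_nonneg_left (le_add_of_nonneg_right (norm_nonneg b)) K.2) hball)
  have hb : ‖(1 - t) • S (α t) b‖ ≤ K * ‖b‖ := by
    rw [norm_smul, Real.norm_of_nonneg (sub_nonneg.2 ht.2)]
    exact (mul_le_of_le_one_left (norm_nonneg _) (sub_le_self _ ht.1)).trans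
      (ContinuousLinearMap.le_of_opNorm_le _ (H.norm_le _ hmem) b)
  refine hp (mem_closedBall_iff_norm.2 ?_)
  rw [shiftedCurve, add_sub_right_comm, mul_add]
  exact norm_add_le_of_le (mem_closedBall_iff_norm.1 hball) hb

theorem exists_endpointMap [CompleteSpace E] (H : IsCommutingFrame S T Ω K) (hΩ : Ω ∈ 𝓝 z₀) :
    ∃ h : E → E, ∃ N ∈ 𝓝 z₀, N ⊆ Ω ∧ IsFirstOrderInvariant S T h N ∧
      ∀ p ∈ N, ∀ p' ∈ N, T p = T p' → h p = h p' → p = p' := by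
  -- `h p` is the endpoint of the trajectory from `p` which moves `T p` to `T z₀`.
  have hΩ' : Ω ∩ {z | ‖T (z₀ - z)‖ < 1} ∈ 𝓝 z₀ :=
    Filter.inter_mem hΩ ((by fun_prop : ContinuousAt (fun z => ‖T (z₀ - z)‖) z₀).eventually_lt_const
      (by simp))
  obtain ⟨N, hN, hball⟩ := exists_mem_nhds_forall_closedBall_subset hΩ'
    (r := fun x => K * (‖T (z₀ - x.1)‖ + ‖T (x.2 - x.1)‖))
    (Continuous.continuousAt (by fun_prop)) (by simp)
  have hself : ∀ p ∈ N, p ∈ Ω ∩ {z | ‖T (z₀ - z)‖ < 1} := fun p hp =>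
    hball p hp p hp (mem_closedBall_self (by positivity))
  have hsmall : ∀ p ∈ N, closedBall p (K * ‖T (z₀ - p)‖) ⊆ Ω := fun p hp => by
    simpa using (hball p hp p hp).trans inter_subset_left
  choose! γ hγ0 hγ using fun p (hp : p ∈ N) => H.exists_trajectory (hsmall p hp)
  refine ⟨fun p => γ p 1, N, hN, fun p hp => (hself p hp).1,
    ⟨Real.exp K * (1 + 2 * K ^ 3), fun p hp p' hp' => ?_⟩, fun p hp p' hp' hT h => ?_⟩
  · have hdir : T (z₀ - p') = T (z₀ - p) - T (p' - p) := by
      rw [← map_sub, sub_sub_sub_cancel_right]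
    have hle := H.norm_endpoint_sub_le (b := T (p' - p)) (by rw [← hdir]; exact (hself p' hp').2.le)
      ((hγ p hp).mono (hsmall p hp))
      (H.mapsTo_shiftedCurve (hγ p hp) ((hball p hp p' hp').trans inter_subset_left))
      (hdir ▸ (hγ p' hp').mono (hsmall p' hp'))
    rw [hγ0 p hp, hγ0 p' hp'] at hle
    rw [mul_assoc]
    refine hle.trans (mul_le_mul_of_nonneg_left ?_ (Real.exp_pos _).le)
    have hcross : 0 ≤ 2 * (K : ℝ) ^ 3 * ‖p' - p - S p (T (p' - p))‖ := by positivity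
    have hsq : 0 ≤ ‖T (p' - p)‖ ^ 2 := by positivity
    linarith
  · have hdir : T (z₀ - p') = T (z₀ - p) := by rw [map_sub, map_sub, hT]
    rw [← hγ0 p hp, ← hγ0 p' hp']
    exact H.trajectory_zero_eq_of_one_eq ((hγ p hp).mono (hsmall p hp))
      (hdir ▸ (hγ p' hp').mono (hsmall p' hp')) h

theorem exists_firstIntegral [CompleteSpace E] (H : IsCommutingFrame S T Ω K) (hΩ : Ω ∈ 𝓝 z₀) :
    ∃ h : E → E, ∃ N ∈ 𝓝 z₀, IsFirstOrderInvariant S T h N ∧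
      ∀ p ∈ N, ∀ p' ∈ N, closedBall p (K * ‖T (p' - p)‖) ⊆ Ω ∧
        (h p' = h p → ∃ α, α 0 = p ∧ α 1 = p' ∧
          IsTrajectory S (closedBall p (K * ‖T (p' - p)‖)) (T (p' - p)) α) := by
  obtain ⟨h, N₁, hN₁, hN₁Ω, hinv, hinj⟩ := H.exists_endpointMap hΩ
  obtain ⟨N, hN, hball⟩ := exists_mem_nhds_forall_closedBall_subset hN₁
    (r := fun x => K * ‖T (x.2 - x.1)‖) (Continuous.continuousAt (by fun_prop)) (by simp)
  have hsub : N ⊆ N₁ := fun p hp => hball p hp p hp (mem_closedBall_self (by positivity))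
  refine ⟨h, N, hN, hinv.mono hsub, fun p hp p' hp' => ⟨(hball p hp p' hp').trans hN₁Ω,
    fun heq => ?_⟩⟩
  obtain ⟨α, h0, hα⟩ := H.exists_trajectory ((hball p hp p' hp').trans hN₁Ω)
  have hα₁ := hα.mono (hball p hp p' hp')
  have hconst : h (α 1) = h (α 0) :=
    eq_of_hasDerivWithinAt_zero (convex_Icc (0 : ℝ) 1) (fun t ht =>
      hinv.hasDerivWithinAt_zero (hα₁.isIntegralCurveOn t ht)
        (by rw [H.proj _ (hN₁Ω (hα₁.mapsTo ht))]) (hα₁.mapsTo ht)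
        (eventually_nhdsWithin_of_forall hα₁.mapsTo)) (by simp) (by simp)
  refine ⟨α, h0, hinj _ (hα₁.mapsTo (by simp)) p' (hsub hp') ?_ ?_, hα⟩
  · rw [H.proj_trajectory (hα₁.mono hN₁Ω), h0, map_sub, add_sub_cancel]
  · rw [hconst, h0, heq]

end IsCommutingFrame

end CommutingFrames

/-! ### Foliation boxes -/

section FoliationBoxes

variable {E H M : Type*} [NormedAddCommGroup E] [NormedSpace ℝ E] [TopologicalSpace H]
  {I : ModelWithCorners ℝ E H} [TopologicalSpace M] [ChartedSpace H M]

/-- The curve `c` has at `t`, within `s`, a velocity which lies in the distribution `F`. -/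
def IsTangentWithinAt (F : ∀ q : M, Submodule ℝ (TangentSpace I q)) (c : ℝ → M) (s : Set ℝ)
    (t : ℝ) : Prop :=
  ∃ v : ℝ →L[ℝ] TangentSpace I (c t), HasMFDerivWithinAt 𝓘(ℝ, ℝ) I c s t v ∧ v 1 ∈ F (c t)

/-- `h` is a first integral of the distribution `F` on the open set `B`, and its level sets in `B`
are, locally, the leaves of `F`. -/
structure IsFoliationBox {E' : Type*} [NormedAddCommGroup E'] [NormedSpace ℝ E']
    (F : ∀ q : M, Submodule ℝ (TangentSpace I q)) (B : Set M) (h : M → E') : Prop where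
  isOpen : IsOpen B
  continuousOn : ContinuousOn h B
  hasDerivWithinAt_zero : ∀ (c : ℝ → M) (s : Set ℝ) (t : ℝ), IsTangentWithinAt F c s t → c t ∈ B →
    HasDerivWithinAt (fun x => h (c x)) 0 s t
  exists_curve : ∀ p ∈ B, ∀ U ∈ 𝓝 p, ∃ N ∈ 𝓝 p, ∀ p' ∈ N, h p' = h p →
    ∃ c : ℝ → M, c 0 = p ∧ c 1 = p' ∧
      ∀ t ∈ Icc (0 : ℝ) 1, c t ∈ U ∧ IsTangentWithinAt F c (Icc 0 1) t
  tangent : ∀ (c : ℝ → M) (t : ℝ) (v : ℝ →L[ℝ] TangentSpace I (c t)),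
    HasMFDerivAt 𝓘(ℝ, ℝ) I c t v → c t ∈ B → (∀ᶠ x in 𝓝 t, h (c x) = h (c t)) → v 1 ∈ F (c t)

theorem IsTangentWithinAt.congr {F F' : ∀ q : M, Submodule ℝ (TangentSpace I q)} {c : ℝ → M}
    {s : Set ℝ} {t : ℝ} (hc : IsTangentWithinAt F c s t) (h : F (c t) = F' (c t)) :
    IsTangentWithinAt F' c s t :=
  hc.imp fun _ hv => ⟨hv.1, h ▸ hv.2⟩

theorem IsFoliationBox.congr {E' : Type*} [NormedAddCommGroup E'] [NormedSpace ℝ E']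
    {F F' : ∀ q : M, Submodule ℝ (TangentSpace I q)} {B : Set M} {h : M → E'}
    (hB : IsFoliationBox F B h) (hF : ∀ q ∈ B, F q = F' q) : IsFoliationBox F' B h where
  isOpen := hB.isOpen
  continuousOn := hB.continuousOn
  hasDerivWithinAt_zero c s t hc ht :=
    hB.hasDerivWithinAt_zero c s t (hc.congr (hF _ ht).symm) ht
  exists_curve p hp U hU := by
    obtain ⟨N, hN, hcurve⟩ := hB.exists_curve p hp _ (Filter.inter_mem hU (hB.isOpen.mem_nhds hp))
    refine ⟨N, hN, fun p' hp' heq => ?_⟩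
    obtain ⟨c, h0, h1, hc⟩ := hcurve p' hp' heq
    exact ⟨c, h0, h1, fun t ht => ⟨(hc t ht).1.1, (hc t ht).2.congr (hF _ (hc t ht).1.2)⟩⟩
  tangent c t v hv ht heq := hF _ ht ▸ hB.tangent c t v hv ht heq

end FoliationBoxes

/-! ### The Frobenius theorem in a vector space -/

section Frobenius

open Metric
open scoped NNReal

variable {E W : Type*} [NormedAddCommGroup E] [NormedSpace ℝ E]
  [NormedAddCommGroup W] [NormedSpace ℝ W]

theorem isTangentWithinAt_iff_hasDerivWithinAt {G : E → Submodule ℝ E} {c : ℝ → E} {s : Set ℝ}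
    {t : ℝ} : IsTangentWithinAt (I := 𝓘(ℝ, E)) G c s t ↔
      ∃ v ∈ G (c t), HasDerivWithinAt c v s t := by
  constructor
  · rintro ⟨(v : ℝ →L[ℝ] E), hv, hG⟩
    exact ⟨v (1 : ℝ), hG,
      HasFDerivWithinAt.hasDerivWithinAt (f' := (v : ℝ →L[ℝ] E)) hv.hasFDerivWithinAt⟩
  · rintro ⟨v, hG, hv⟩
    exact ⟨ContinuousLinearMap.toSpanSingleton ℝ v, hv.hasFDerivWithinAt.hasMFDerivWithinAt,
      (ContinuousLinearMap.toSpanSingleton_apply_one ℝ v).symm ▸ hG⟩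

namespace IsCommutingFrame

variable {S : E → W →L[ℝ] E} {T : E →L[ℝ] W} {Ω : Set E} {K : ℝ≥0} {z₀ : E}

theorem apply_proj (H : IsCommutingFrame S T Ω K) {z v : E} (hz : z ∈ Ω) (hv : v ∈ (S z).range) :
    S z (T v) = v := by
  obtain ⟨a, rfl⟩ := hv
  exact congrArg (S z) (H.proj z hz a)

theorem mem_range_of_hasDerivAt (H : IsCommutingFrame S T Ω K) {c : ℝ → E} {t : ℝ} {v : E}
    (hc : HasDerivAt c v t) (hball : ∀ᶠ x in 𝓝 t, closedBall (c t) (K * ‖T (c x - c t)‖) ⊆ Ω)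
    (hjoin : ∀ᶠ x in 𝓝 t, ∃ α, α 0 = c t ∧ α 1 = c x ∧
      IsTrajectory S (closedBall (c t) (K * ‖T (c x - c t)‖)) (T (c x - c t)) α) :
    v ∈ (S (c t)).range := by
  set L : E →L[ℝ] E := ContinuousLinearMap.id ℝ E - (S (c t)).comp T
  suffices hLv : L v = 0 from ⟨T v, (sub_eq_zero.1 hLv).symm⟩
  have hsq : (fun x => L (c x) - L (c t)) =O[𝓝 t] fun x => ‖T (c x - c t)‖ ^ 2 := by
    refine Asymptotics.IsBigO.of_bound (K ^ 2) ?_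
    filter_upwards [hball, hjoin] with x hx ⟨α, h0, h1, hα⟩
    have hle := H.norm_displacement_sub_le hx hα h0
    rw [h1] at hle
    rwa [norm_pow, norm_norm, ← map_sub]
  have hO := (((T.isBigO_comp _ _).trans hc.differentiableAt.isBigO_sub).norm_norm).pow 2
  have ho : (fun x : ℝ => ‖x - t‖ ^ 2) =o[𝓝 t] fun x => x - t :=
    Asymptotics.isLittleO_pow_sub_sub t one_lt_two
  have hd : HasDerivAt (fun x => L (c x)) 0 t := by
    rw [hasDerivAt_iff_isLittleO]
    simpa only [smul_zero, sub_zero] using (hsq.trans hO).trans_isLittleO ho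
  exact (L.hasFDerivAt.comp_hasDerivAt t hc).unique hd

theorem exists_isFoliationBox [CompleteSpace E] (H : IsCommutingFrame S T Ω K) (hΩ : Ω ∈ 𝓝 z₀) :
    ∃ B ⊆ Ω, ∃ h : E → E, z₀ ∈ B ∧ IsFoliationBox (I := 𝓘(ℝ, E)) (fun z => (S z).range) B h := by
  obtain ⟨h, N, hN, hinv, hjoin⟩ := H.exists_firstIntegral hΩ
  have hNΩ : N ⊆ Ω := fun p hp => (hjoin p hp p hp).1 (mem_closedBall_self (by positivity))
  have hnear : ∀ p ∈ interior N, N ∈ 𝓝 p := fun p hp => mem_interior_iff_mem_nhds.1 hp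
  refine ⟨interior N, interior_subset.trans hNΩ, h, mem_interior_iff_mem_nhds.2 hN,
    isOpen_interior, hinv.continuousOn.mono interior_subset, fun c s t hc ht => ?_,
    fun p hp U hU => ?_, fun c t v hv ht hev => ?_⟩
  · obtain ⟨v, hv, hcv⟩ := isTangentWithinAt_iff_hasDerivWithinAt.1 hc
    exact hinv.hasDerivWithinAt_zero hcv (H.apply_proj (hNΩ (interior_subset ht)) hv)
      (interior_subset ht) (hcv.continuousWithinAt.eventually (hnear _ ht))
  · obtain ⟨N', hN', hball⟩ := exists_mem_nhds_forall_closedBall_subset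
      (Filter.inter_mem hU (hnear p hp)) (r := fun x => K * ‖T (x.2 - x.1)‖)
      (Continuous.continuousAt (by fun_prop)) (by simp)
    have hpN' := mem_of_mem_nhds hN'
    refine ⟨N' ∩ N, Filter.inter_mem hN' (hnear p hp), fun p' hp' heq => ?_⟩
    obtain ⟨α, h0, h1, hα⟩ := (hjoin p (interior_subset hp) p' hp'.2).2 heq
    refine ⟨α, h0, h1, fun t ht => ⟨(hball p hpN' p' hp'.1 (hα.mapsTo ht)).1, ?_⟩⟩
    exact isTangentWithinAt_iff_hasDerivWithinAt.2 ⟨_, ⟨_, rfl⟩, hα.isIntegralCurveOn t ht⟩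
  · have hd : HasDerivAt c (v (1 : ℝ) : E) t :=
      HasFDerivAt.hasDerivAt (f' := (v : ℝ →L[ℝ] E)) hv.hasFDerivAt
    have hN_ev := hd.continuousAt.eventually (hnear _ ht)
    refine H.mem_range_of_hasDerivAt hd
      (hN_ev.mono fun x hx => (hjoin _ (interior_subset ht) _ hx).1)
      (hev.and hN_ev |>.mono fun x hx => (hjoin _ (interior_subset ht) _ hx.2).2 hx.1)

end IsCommutingFrame

/-- On `Ω`, the bracket of smooth vector fields with values in `G` has values in `G`. -/
def IsInvolutiveOn (G : E → Submodule ℝ E) (Ω : Set E) : Prop :=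
  ∀ U ⊆ Ω, IsOpen U → ∀ X Y : E → E, ContDiffOn ℝ ∞ X U → ContDiffOn ℝ ∞ Y U →
    (∀ z ∈ U, X z ∈ G z) → (∀ z ∈ U, Y z ∈ G z) →
    ∀ z ∈ U, VectorField.lieBracket ℝ X Y z ∈ G z

theorem IsInvolutiveOn.congr_mono {G G' : E → Submodule ℝ E} {Ω Ω' : Set E}
    (h : IsInvolutiveOn G Ω) (hΩ : Ω' ⊆ Ω) (hG : ∀ z ∈ Ω', G z = G' z) : IsInvolutiveOn G' Ω' := by
  intro U hU hUo X Y hX hY hXG hYG z hz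
  rw [← hG z (hU hz)]
  exact h U (hU.trans hΩ) hUo X Y hX hY (fun z hz => hG z (hU hz) ▸ hXG z hz)
    (fun z hz => hG z (hU hz) ▸ hYG z hz) z hz

theorem fderiv_apply_comm_of_isInvolutiveOn {Ω : Set E} (hΩ : IsOpen Ω) {S : E → W →L[ℝ] E}
    {T : E →L[ℝ] W} (hS : ContDiffOn ℝ ∞ S Ω) (hT : ∀ z ∈ Ω, ∀ a, T (S z a) = a)
    (hinv : IsInvolutiveOn (fun z => (S z).range) Ω) {z : E} (hz : z ∈ Ω) (a b : W) :
    fderiv ℝ S z (S z a) b = fderiv ℝ S z (S z b) a := by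
  have hd : DifferentiableAt ℝ S z :=
    (hS.contDiffAt (hΩ.mem_nhds hz)).differentiableAt (by simp)
  have hfderiv (c : W) (u : E) : fderiv ℝ (fun z => S z c) z u = fderiv ℝ S z u c := by
    simp [fderiv_clm_apply hd (differentiableAt_const c)]
  have hT_fderiv (c : W) (u : E) : T (fderiv ℝ S z u c) = 0 := by
    have hcomp : HasFDerivAt (fun z => T (S z c)) (T.comp (fderiv ℝ (fun z => S z c) z)) z :=
      T.hasFDerivAt.comp z (hd.clm_apply (differentiableAt_const c)).hasFDerivAt
    have hconst : (fun z => T (S z c)) =ᶠ[𝓝 z] fun _ => c := by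
      filter_upwards [hΩ.mem_nhds hz] with y hy using hT y hy c
    rw [← hfderiv]
    exact DFunLike.congr_fun
      (hcomp.unique ((hasFDerivAt_const c z).congr_of_eventuallyEq hconst)) u
  have hX (c : W) : ContDiffOn ℝ ∞ (fun z => S z c) Ω := hS.clm_apply contDiffOn_const
  obtain ⟨w, hw⟩ := hinv Ω subset_rfl hΩ _ _ (hX a) (hX b) (fun z _ => ⟨a, rfl⟩)
    (fun z _ => ⟨b, rfl⟩) z hz
  -- The bracket is the difference of the two sides; it lies in the range of `S z` and in `ker T`.
  replace hw : S z w = fderiv ℝ S z (S z a) b - fderiv ℝ S z (S z b) a :=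
    hw.trans (by rw [VectorField.lieBracket, hfderiv, hfderiv])
  have hw0 : w = 0 := by rw [← hT z hz w, hw, map_sub, hT_fderiv, hT_fderiv, sub_zero]
  rw [hw0, map_zero] at hw
  exact sub_eq_zero.1 hw.symm

theorem exists_normalized_frame [FiniteDimensional ℝ E] [CompleteSpace W] {Ω : Set E}
    (hΩ : IsOpen Ω) {z₀ : E} (hz₀ : z₀ ∈ Ω) {S₀ : E → W →L[ℝ] E} (hS₀ : ContDiffOn ℝ ∞ S₀ Ω)
    (hinj : Function.Injective (S₀ z₀)) :
    ∃ (S : E → W →L[ℝ] E) (T : E →L[ℝ] W) (Ω' : Set E), IsOpen Ω' ∧ z₀ ∈ Ω' ∧ Ω' ⊆ Ω ∧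
      ContDiffOn ℝ ∞ S Ω' ∧ (∀ z ∈ Ω', ∀ a, T (S z a) = a) ∧
      ∀ z ∈ Ω', (S z).range = (S₀ z).range := by
  obtain ⟨T₀, hT₀⟩ := (S₀ z₀).toLinearMap.exists_leftInverse_of_injective
    (LinearMap.ker_eq_bot.2 hinj)
  set T : E →L[ℝ] W := LinearMap.toContinuousLinearMap T₀
  set M : E → W →L[ℝ] W := fun z => T.comp (S₀ z)
  have hM₀ : M z₀ = ContinuousLinearEquiv.refl ℝ W := by
    ext a
    exact DFunLike.congr_fun hT₀ a
  have hM : ContDiffOn ℝ ∞ M Ω := contDiffOn_const.clm_comp hS₀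
  have hMinv : ∀ᶠ z in 𝓝 z₀, (M z).IsInvertible :=
    (hM.contDiffAt (hΩ.mem_nhds hz₀)).continuousAt
      (hM₀ ▸ ContinuousLinearEquiv.nhds (ContinuousLinearEquiv.refl ℝ W))
  obtain ⟨Ω', hsub, hΩ', hz₀'⟩ := _root_.mem_nhds_iff.1 (hMinv.and (hΩ.mem_nhds hz₀))
  refine ⟨fun z => (S₀ z).comp (M z).inverse, T, Ω', hΩ', hz₀', fun z hz => (hsub hz).2,
    fun z hz => ContDiffAt.contDiffWithinAt ?_,
    fun z hz a => (hsub hz).1.self_apply_inverse a, fun z hz => ?_⟩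
  · have hnhds := hΩ.mem_nhds (hsub hz).2
    exact (hS₀.contDiffAt hnhds).clm_comp
      ((hsub hz).1.contDiffAt_map_inverse.comp z (hM.contDiffAt hnhds))
  · exact LinearMap.range_comp_of_range_eq_top _
      (LinearMap.range_eq_top.2 (hsub hz).1.inverse.surjective)

theorem exists_isCommutingFrame {Ω : Set E} (hΩ : IsOpen Ω) {z₀ : E} (hz₀ : z₀ ∈ Ω)
    {S : E → W →L[ℝ] E} {T : E →L[ℝ] W} (hS : ContDiffOn ℝ ∞ S Ω)
    (hT : ∀ z ∈ Ω, ∀ a, T (S z a) = a)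
    (hcomm : ∀ z ∈ Ω, ∀ a b, fderiv ℝ S z (S z a) b = fderiv ℝ S z (S z b) a) :
    ∃ Ω' ⊆ Ω, ∃ K, Ω' ∈ 𝓝 z₀ ∧ IsCommutingFrame S T Ω' K := by
  have hS₀ := hS.contDiffAt (hΩ.mem_nhds hz₀)
  have hS' : ContDiffAt ℝ 1 (fderiv ℝ S) z₀ :=
    hS₀.fderiv_right (by norm_num; exact WithTop.coe_le_coe.2 le_top)
  obtain ⟨K₁, t, ht, hlip⟩ := hS'.exists_lipschitzOnWith
  have hnorm : ∀ᶠ z in 𝓝 z₀, ‖S z‖₊ < ‖S z₀‖₊ + 1 :=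
    hS₀.continuousAt.nnnorm.eventually_lt_const (lt_add_one _)
  have hnorm' : ∀ᶠ z in 𝓝 z₀, ‖fderiv ℝ S z‖₊ < ‖fderiv ℝ S z₀‖₊ + 1 :=
    hS'.continuousAt.nnnorm.eventually_lt_const (lt_add_one _)
  obtain ⟨R, hR, hsub⟩ := nhds_basis_ball.mem_iff.1
    (Filter.inter_mem (Filter.inter_mem ht (hΩ.mem_nhds hz₀)) (hnorm.and hnorm'))
  have hΩ' : ball z₀ R ⊆ Ω := fun z hz => (hsub hz).1.2
  refine ⟨ball z₀ R, hΩ', K₁ + (‖S z₀‖₊ + 1) + (‖fderiv ℝ S z₀‖₊ + 1), ball_mem_nhds z₀ hR,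
    convex_ball z₀ R, le_add_left le_add_self, fun z hz => ?_, fun z hz => ?_, fun z hz => ?_,
    (hlip.mono fun z hz => (hsub hz).1.1).weaken (le_add_right le_self_add),
    fun z hz => hcomm z (hΩ' hz), fun z hz => hT z (hΩ' hz)⟩
  · exact (hS.contDiffAt (hΩ.mem_nhds (hΩ' hz))).differentiableAt (by simp)
  · exact NNReal.coe_le_coe.2 ((hsub hz).2.1.le.trans (le_add_right le_add_self))
  · exact NNReal.coe_le_coe.2 ((hsub hz).2.2.le.trans le_add_self)

theorem IsInvolutiveOn.exists_isFoliationBox [FiniteDimensional ℝ E] [CompleteSpace W]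
    {G : E → Submodule ℝ E} {Ω : Set E} (hinv : IsInvolutiveOn G Ω) (hΩ : IsOpen Ω) {z₀ : E}
    (hz₀ : z₀ ∈ Ω) {S₀ : E → W →L[ℝ] E} (hS₀ : ContDiffOn ℝ ∞ S₀ Ω)
    (hinj : Function.Injective (S₀ z₀)) (hG : ∀ z ∈ Ω, G z = (S₀ z).range) :
    ∃ B ⊆ Ω, ∃ h : E → E, z₀ ∈ B ∧ IsFoliationBox (I := 𝓘(ℝ, E)) G B h := by
  have : CompleteSpace E := FiniteDimensional.complete ℝ E
  obtain ⟨S, T, Ω', hΩ', hz₀', hsub, hS, hT, hrange⟩ := exists_normalized_frame hΩ hz₀ hS₀ hinj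
  have hG' : ∀ z ∈ Ω', G z = (S z).range := fun z hz => (hG z (hsub hz)).trans (hrange z hz).symm
  have hcomm := fun z (hz : z ∈ Ω') => fderiv_apply_comm_of_isInvolutiveOn hΩ' hS hT
    (hinv.congr_mono hsub hG') hz
  obtain ⟨Ω'', hsub', K, hΩ'', H⟩ := exists_isCommutingFrame hΩ' hz₀' hS hT hcomm
  obtain ⟨B, hBΩ, h, hz₀B, hB⟩ := H.exists_isFoliationBox hΩ''
  exact ⟨B, (hBΩ.trans hsub').trans hsub, h, hz₀B,
    hB.congr fun z hz => (hG' z (hsub' (hBΩ hz))).symm⟩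

end Frobenius

/-! ### Tangent maps of charts -/

section Charts

variable {m : ℕ} {M : Type*} [TopologicalSpace M] [ChartedSpace (EuclideanSpace ℝ (Fin m)) M]

/-- The tangent map at `x` of the chart at `x₀`. -/
def chartD (x₀ x : M) : TangentSpace (𝓡 m) x →L[ℝ] EuclideanSpace ℝ (Fin m) :=
  mfderiv (𝓡 m) 𝓘(ℝ, EuclideanSpace ℝ (Fin m)) (extChartAt (𝓡 m) x₀) x

/-- The tangent map at `z` of the inverse of the chart at `x₀`. -/
def chartSymmD (x₀ : M) (z : EuclideanSpace ℝ (Fin m)) :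
    EuclideanSpace ℝ (Fin m) →L[ℝ] TangentSpace (𝓡 m) ((extChartAt (𝓡 m) x₀).symm z) :=
  mfderiv 𝓘(ℝ, EuclideanSpace ℝ (Fin m)) (𝓡 m) (extChartAt (𝓡 m) x₀).symm z

variable [IsManifold (𝓡 m) ∞ M] {x₀ x : M} {z : EuclideanSpace ℝ (Fin m)}

theorem chartD_chartSymmD (hz : z ∈ (extChartAt (𝓡 m) x₀).target) (u : EuclideanSpace ℝ (Fin m)) :
    chartD x₀ ((extChartAt (𝓡 m) x₀).symm z) (chartSymmD x₀ z u) = u := by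
  have h := mfderiv_extChartAt_comp_mfderivWithin_extChartAt_symm hz
  rw [ModelWithCorners.range_eq_univ, mfderivWithin_univ] at h
  exact congrArg (fun L : EuclideanSpace ℝ (Fin m) →L[ℝ] EuclideanSpace ℝ (Fin m) => L u) h

theorem chartSymmD_chartD (hx : x ∈ (extChartAt (𝓡 m) x₀).source) (u : TangentSpace (𝓡 m) x) :
    chartSymmD x₀ (extChartAt (𝓡 m) x₀ x) (chartD x₀ x u) = u := by
  have h := mfderivWithin_extChartAt_symm_comp_mfderiv_extChartAt' (I := 𝓡 m) hx
  rw [ModelWithCorners.range_eq_univ, mfderivWithin_univ] at h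
  exact congrArg (fun L : EuclideanSpace ℝ (Fin m) →L[ℝ] EuclideanSpace ℝ (Fin m) => L u) h

theorem isInvertible_chartD (hx : x ∈ (extChartAt (𝓡 m) x₀).source) :
    (chartD (m := m) x₀ x).IsInvertible :=
  isInvertible_mfderiv_extChartAt hx

theorem chartD_self : chartD (m := m) x₀ x₀ = ContinuousLinearMap.id ℝ (EuclideanSpace ℝ (Fin m)) :=
  mfderiv_extChartAt_self (I := 𝓡 m)

theorem hasMFDerivAt_chart (hx : x ∈ (extChartAt (𝓡 m) x₀).source) :
    HasMFDerivAt (𝓡 m) 𝓘(ℝ, EuclideanSpace ℝ (Fin m)) (extChartAt (𝓡 m) x₀) x (chartD x₀ x) :=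
  (mdifferentiableAt_extChartAt (by rwa [extChartAt_source] at hx)).hasMFDerivAt

theorem contMDiffAt_chart_symm (hz : z ∈ (extChartAt (𝓡 m) x₀).target) :
    ContMDiffAt 𝓘(ℝ, EuclideanSpace ℝ (Fin m)) (𝓡 m) ∞ (extChartAt (𝓡 m) x₀).symm z :=
  (contMDiffOn_extChartAt_symm x₀).contMDiffAt ((isOpen_extChartAt_target x₀).mem_nhds hz)

theorem contMDiffAt_chart (hx : x ∈ (extChartAt (𝓡 m) x₀).source) :
    ContMDiffAt (𝓡 m) 𝓘(ℝ, EuclideanSpace ℝ (Fin m)) ∞ (extChartAt (𝓡 m) x₀) x :=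
  contMDiffAt_extChartAt' (by rwa [extChartAt_source] at hx)

theorem hasMFDerivAt_chart_symm (hz : z ∈ (extChartAt (𝓡 m) x₀).target) :
    HasMFDerivAt 𝓘(ℝ, EuclideanSpace ℝ (Fin m)) (𝓡 m) (extChartAt (𝓡 m) x₀).symm z
      (chartSymmD x₀ z) :=
  ((contMDiffAt_chart_symm hz).mdifferentiableAt (by simp)).hasMFDerivAt

theorem contMDiffAt_chartD_apply {H E' N : Type*} [NormedAddCommGroup E'] [NormedSpace ℝ E']
    [TopologicalSpace H] {I : ModelWithCorners ℝ E' H} [TopologicalSpace N] [ChartedSpace H N]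
    {f : N → M} {X : ∀ y, TangentSpace (𝓡 m) (f y)} {y : N}
    (hX : ContMDiffAt I (𝓡 m).tangent ∞ (fun y => (⟨f y, X y⟩ : TangentBundle (𝓡 m) M)) y)
    (hy : f y ∈ (extChartAt (𝓡 m) x₀).source) :
    ContMDiffAt I 𝓘(ℝ, EuclideanSpace ℝ (Fin m)) ∞ (fun y => chartD x₀ (f y) (X y)) y := by
  have hopen := isOpen_extChartAt_source (I := 𝓡 m) x₀
  have htangentMap : ContMDiffOn (𝓡 m).tangent 𝓘(ℝ, EuclideanSpace ℝ (Fin m)).tangent ∞ _ _ :=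
    ContMDiffOn.contMDiffOn_tangentMapWithin
      (f := extChartAt (𝓡 m) x₀) (I := 𝓡 m) (s := (extChartAt (𝓡 m) x₀).source) (m := ∞) (n := ∞)
      (I' := 𝓘(ℝ, EuclideanSpace ℝ (Fin m)))
      (fun x hx => (contMDiffAt_chart hx).contMDiffWithinAt) le_rfl hopen.uniqueMDiffOn
  have htangentMap_at := htangentMap.contMDiffAt (x := (⟨f y, X y⟩ : TangentBundle (𝓡 m) M))
    ((hopen.preimage (FiberBundle.continuous_proj _ _)).mem_nhds hy)
  have hsnd := (contMDiff_snd_tangentBundle_modelSpace (n := ∞) (EuclideanSpace ℝ (Fin m))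
    𝓘(ℝ, EuclideanSpace ℝ (Fin m))).contMDiffAt.comp y (htangentMap_at.comp y hX)
  refine hsnd.congr_of_eventuallyEq ?_
  have hf : ContinuousAt f y :=
    (FiberBundle.continuous_proj (EuclideanSpace ℝ (Fin m))
      (TangentSpace (𝓡 m) : M → Type _)).continuousAt.comp hX.continuousAt
  filter_upwards [hf (hopen.mem_nhds hy)] with w hw
  change chartD x₀ (f w) (X w) = mfderivWithin _ _ _ _ _ _
  rw [mfderivWithin_of_isOpen hopen hw]
  rfl

end Charts

/-! ### The Frobenius theorem on a manifold -/

section ManifoldFrobenius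

variable {n r : ℕ} {Q : Type*} [TopologicalSpace Q] [ChartedSpace (EuclideanSpace ℝ (Fin n)) Q]
  {F : ∀ q : Q, Submodule ℝ (TangentSpace (𝓡 n) q)} {q₀ : Q}

/-- The expression of the distribution `F` in the chart at `q₀`; only its values on the target of
that chart are meaningful. -/
def distributionInChart (F : ∀ q : Q, Submodule ℝ (TangentSpace (𝓡 n) q)) (q₀ : Q)
    (z : EuclideanSpace ℝ (Fin n)) : Submodule ℝ (EuclideanSpace ℝ (Fin n)) :=
  (F ((extChartAt (𝓡 n) q₀).symm z)).comap (chartSymmD q₀ z).toLinearMap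

variable [IsManifold (𝓡 n) ∞ Q]

theorem chartD_mem_distributionInChart_iff {q : Q} (hq : q ∈ (extChartAt (𝓡 n) q₀).source)
    {v : TangentSpace (𝓡 n) q} :
    chartD q₀ q v ∈ distributionInChart F q₀ (extChartAt (𝓡 n) q₀ q) ↔ v ∈ F q := by
  change chartSymmD q₀ _ (chartD q₀ q v) ∈ F _ ↔ _
  rw [chartSymmD_chartD hq, (extChartAt (𝓡 n) q₀).left_inv hq]

theorem IsTangentWithinAt.chart_comp {c : ℝ → Q} {s : Set ℝ} {t : ℝ}
    (hc : IsTangentWithinAt F c s t) (ht : c t ∈ (extChartAt (𝓡 n) q₀).source) :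
    IsTangentWithinAt (I := 𝓘(ℝ, EuclideanSpace ℝ (Fin n))) (distributionInChart F q₀)
      (fun x => extChartAt (𝓡 n) q₀ (c x)) s t := by
  obtain ⟨v, hv, hF⟩ := hc
  exact ⟨(chartD q₀ (c t)).comp v, (hasMFDerivAt_chart ht).comp_hasMFDerivWithinAt t hv,
    (chartD_mem_distributionInChart_iff ht).2 hF⟩

theorem IsTangentWithinAt.chart_symm_comp {α : ℝ → EuclideanSpace ℝ (Fin n)} {s : Set ℝ} {t : ℝ}
    (hα : IsTangentWithinAt (I := 𝓘(ℝ, EuclideanSpace ℝ (Fin n))) (distributionInChart F q₀) α s t)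
    (ht : α t ∈ (extChartAt (𝓡 n) q₀).target) :
    IsTangentWithinAt F (fun x => (extChartAt (𝓡 n) q₀).symm (α x)) s t := by
  obtain ⟨v, hv, hF⟩ := hα
  exact ⟨(chartSymmD q₀ (α t)).comp v, (hasMFDerivAt_chart_symm ht).comp_hasMFDerivWithinAt t hv,
    hF⟩

theorem IsFoliationBox.comp_chart {E' : Type*} [NormedAddCommGroup E'] [NormedSpace ℝ E']
    {B : Set (EuclideanSpace ℝ (Fin n))} {h : EuclideanSpace ℝ (Fin n) → E'}
    (hB : IsFoliationBox (I := 𝓘(ℝ, EuclideanSpace ℝ (Fin n))) (distributionInChart F q₀) B h) :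
    IsFoliationBox F ((extChartAt (𝓡 n) q₀).source ∩ extChartAt (𝓡 n) q₀ ⁻¹' B)
      (fun q => h (extChartAt (𝓡 n) q₀ q)) where
  isOpen := (continuousOn_extChartAt q₀).isOpen_inter_preimage (isOpen_extChartAt_source q₀)
    hB.isOpen
  continuousOn := hB.continuousOn.comp ((continuousOn_extChartAt q₀).mono inter_subset_left)
    fun _ hq => hq.2
  hasDerivWithinAt_zero c s t hc ht := hB.hasDerivWithinAt_zero _ s t (hc.chart_comp ht.1) ht.2
  exists_curve := by
    rintro p ⟨hp, hpB⟩ U hU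
    set φ := extChartAt (𝓡 n) q₀
    have hpre : φ.symm ⁻¹' U ∩ φ.target ∈ 𝓝 (φ p) :=
      Filter.inter_mem (continuousAt_extChartAt_symm' hp (by rwa [φ.left_inv hp]))
        (extChartAt_target_mem_nhds' (φ.map_source hp))
    obtain ⟨N, hN, hcurve⟩ := hB.exists_curve _ hpB _ hpre
    refine ⟨φ ⁻¹' N ∩ φ.source, Filter.inter_mem (continuousAt_extChartAt' hp hN)
      ((isOpen_extChartAt_source q₀).mem_nhds hp), ?_⟩
    rintro p' ⟨hp'N, hp'⟩ heq
    obtain ⟨α, h0, h1, hα⟩ := hcurve _ hp'N heq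
    exact ⟨fun t => φ.symm (α t), by simp only [h0, φ.left_inv hp],
      by simp only [h1, φ.left_inv hp'],
      fun t ht => ⟨(hα t ht).1.1, (hα t ht).2.chart_symm_comp (hα t ht).1.2⟩⟩
  tangent c t v hv ht heq := (chartD_mem_distributionInChart_iff ht.1).1
    (hB.tangent _ t _ ((hasMFDerivAt_chart ht.1).comp t hv) ht.2 heq)

theorem mlieBracket_eq_lieBracket {E : Type*} [NormedAddCommGroup E] [NormedSpace ℝ E]
    (X Y : ∀ z : E, TangentSpace 𝓘(ℝ, E) z) :
    VectorField.mlieBracket 𝓘(ℝ, E) X Y = VectorField.lieBracket ℝ X Y := by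
  rw [← VectorField.mlieBracketWithin_univ, VectorField.mlieBracketWithin_eq_lieBracketWithin]
  exact VectorField.lieBracketWithin_univ

theorem mpullback_chart_apply (X : EuclideanSpace ℝ (Fin n) → EuclideanSpace ℝ (Fin n)) {q : Q}
    (hq : q ∈ (extChartAt (𝓡 n) q₀).source) :
    VectorField.mpullback (𝓡 n) 𝓘(ℝ, EuclideanSpace ℝ (Fin n)) (extChartAt (𝓡 n) q₀) X q =
      chartSymmD q₀ (extChartAt (𝓡 n) q₀ q) (X (extChartAt (𝓡 n) q₀ q)) := by
  refine (isInvertible_chartD (m := n) hq).inverse_apply_eq.2 ?_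
  have := chartD_chartSymmD ((extChartAt (𝓡 n) q₀).map_source hq) (X (extChartAt (𝓡 n) q₀ q))
  rw [(extChartAt (𝓡 n) q₀).left_inv hq] at this
  exact this.symm

theorem mpullback_chart_mem_iff (X : EuclideanSpace ℝ (Fin n) → EuclideanSpace ℝ (Fin n)) {q : Q}
    (hq : q ∈ (extChartAt (𝓡 n) q₀).source) :
    VectorField.mpullback (𝓡 n) 𝓘(ℝ, EuclideanSpace ℝ (Fin n)) (extChartAt (𝓡 n) q₀) X q ∈ F q ↔
      X (extChartAt (𝓡 n) q₀ q) ∈ distributionInChart F q₀ (extChartAt (𝓡 n) q₀ q) := by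
  rw [← chartD_mem_distributionInChart_iff hq]
  exact (congrArg (· ∈ _) ((isInvertible_chartD (m := n) hq).self_apply_inverse _)).to_iff

theorem contMDiffOn_mpullback_chart {U : Set (EuclideanSpace ℝ (Fin n))} (hU : IsOpen U)
    {X : EuclideanSpace ℝ (Fin n) → EuclideanSpace ℝ (Fin n)} (hX : ContDiffOn ℝ ∞ X U) :
    ContMDiffOn (𝓡 n) (𝓡 n).tangent ∞ (fun q => (⟨q, VectorField.mpullback (𝓡 n)
        𝓘(ℝ, EuclideanSpace ℝ (Fin n)) (extChartAt (𝓡 n) q₀) X q⟩ : TangentBundle (𝓡 n) Q))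
      ((extChartAt (𝓡 n) q₀).source ∩ extChartAt (𝓡 n) q₀ ⁻¹' U) := fun _ hq =>
  (ContMDiffAt.mpullback_vectorField_preimage (n := ∞)
    (contMDiffAt_vectorSpace_iff_contDiffAt.2 (hX.contDiffAt (hU.mem_nhds hq.2)))
    (contMDiffAt_chart hq.1) (isInvertible_chartD hq.1) le_rfl).contMDiffWithinAt

theorem mpullback_chart_lieBracket {X Y : EuclideanSpace ℝ (Fin n) → EuclideanSpace ℝ (Fin n)}
    {q : Q} (hq : q ∈ (extChartAt (𝓡 n) q₀).source)
    (hX : ContDiffAt ℝ ∞ X (extChartAt (𝓡 n) q₀ q))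
    (hY : ContDiffAt ℝ ∞ Y (extChartAt (𝓡 n) q₀ q)) :
    VectorField.mpullback (𝓡 n) 𝓘(ℝ, EuclideanSpace ℝ (Fin n)) (extChartAt (𝓡 n) q₀)
        (VectorField.lieBracket ℝ X Y) q =
      VectorField.mlieBracket (𝓡 n)
        (VectorField.mpullback (𝓡 n) 𝓘(ℝ, EuclideanSpace ℝ (Fin n)) (extChartAt (𝓡 n) q₀) X)
        (VectorField.mpullback (𝓡 n) 𝓘(ℝ, EuclideanSpace ℝ (Fin n)) (extChartAt (𝓡 n) q₀) Y) q := by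
  have hsmooth : minSmoothness ℝ 2 = 2 := minSmoothness_of_isRCLikeNormedField
  have : IsManifold (𝓡 n) (minSmoothness ℝ 2) Q := by rw [hsmooth]; infer_instance
  have hdiff {Z : EuclideanSpace ℝ (Fin n) → EuclideanSpace ℝ (Fin n)}
      (hZ : ContDiffAt ℝ ∞ Z (extChartAt (𝓡 n) q₀ q)) :=
    (contMDiffAt_vectorSpace_iff_contDiffAt.2 hZ).mdifferentiableAt (by simp)
  have hbracket := VectorField.mpullback_mlieBracket (hdiff hX) (hdiff hY)
    (contMDiffAt_chart hq) (n := ∞) (by rw [hsmooth]; exact WithTop.coe_le_coe.2 le_top)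
  exact (congrArg (fun Z : ∀ z : EuclideanSpace ℝ (Fin n),
    TangentSpace 𝓘(ℝ, EuclideanSpace ℝ (Fin n)) z => VectorField.mpullback (𝓡 n)
      𝓘(ℝ, EuclideanSpace ℝ (Fin n)) (extChartAt (𝓡 n) q₀) Z q)
    (mlieBracket_eq_lieBracket X Y)).symm.trans hbracket

theorem IsInvolutive.isInvolutiveOn_distributionInChart (hF : IsInvolutive F) (q₀ : Q) :
    IsInvolutiveOn (distributionInChart F q₀) (extChartAt (𝓡 n) q₀).target := by
  intro U hUt hU X Y hX hY hXF hYF z hz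
  obtain ⟨q, hq, rfl⟩ : z ∈ extChartAt (𝓡 n) q₀ '' (extChartAt (𝓡 n) q₀).source :=
    (extChartAt (𝓡 n) q₀).image_source_eq_target ▸ hUt hz
  rw [← mpullback_chart_mem_iff _ hq,
    mpullback_chart_lieBracket hq (hX.contDiffAt (hU.mem_nhds hz)) (hY.contDiffAt (hU.mem_nhds hz))]
  exact hF _ ((continuousOn_extChartAt q₀).isOpen_inter_preimage (isOpen_extChartAt_source q₀) hU)
    _ _ (contMDiffOn_mpullback_chart hU hX) (contMDiffOn_mpullback_chart hU hY)
    (fun p hp => (mpullback_chart_mem_iff _ hp.1).2 (hXF _ hp.2))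
    (fun p hp => (mpullback_chart_mem_iff _ hp.1).2 (hYF _ hp.2)) q ⟨hq, hz⟩

theorem mem_distributionInChart_iff {z u : EuclideanSpace ℝ (Fin n)}
    (hz : z ∈ (extChartAt (𝓡 n) q₀).target) :
    u ∈ distributionInChart F q₀ z ↔ ∃ v ∈ F ((extChartAt (𝓡 n) q₀).symm z), chartD q₀ _ v = u := by
  refine ⟨fun hu => ⟨_, hu, chartD_chartSymmD hz u⟩, ?_⟩
  rintro ⟨v, hv, rfl⟩
  have := (chartD_mem_distributionInChart_iff ((extChartAt (𝓡 n) q₀).map_target hz)).2 hv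
  rwa [(extChartAt (𝓡 n) q₀).right_inv hz] at this

theorem IsDistribution.exists_frame_inChart (hd : IsDistribution F r) (q₀ : Q) :
    ∃ (Ω : Set (EuclideanSpace ℝ (Fin n)))
      (S : EuclideanSpace ℝ (Fin n) → (Fin r → ℝ) →L[ℝ] EuclideanSpace ℝ (Fin n)),
      IsOpen Ω ∧ extChartAt (𝓡 n) q₀ q₀ ∈ Ω ∧ Ω ⊆ (extChartAt (𝓡 n) q₀).target ∧
      ContDiffOn ℝ ∞ S Ω ∧ Function.Injective (S (extChartAt (𝓡 n) q₀ q₀)) ∧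
      ∀ z ∈ Ω, distributionInChart F q₀ z = (S z).range := by
  obtain ⟨U, hU, hq₀, s, hs, hspan⟩ := hd q₀
  set φ := extChartAt (𝓡 n) q₀
  have hz₀ : φ q₀ ∈ φ.target ∩ φ.symm ⁻¹' U := ⟨mem_extChartAt_target q₀, by
    rwa [mem_preimage, φ.left_inv (mem_extChartAt_source q₀)]⟩
  let S : EuclideanSpace ℝ (Fin n) → (Fin r → ℝ) →L[ℝ] EuclideanSpace ℝ (Fin n) := fun z =>
    ∑ i, (ContinuousLinearMap.proj i : (Fin r → ℝ) →L[ℝ] ℝ).smulRight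
      (chartD q₀ (φ.symm z) (s i (φ.symm z)))
  have hS_apply (z a) : S z a = chartD q₀ (φ.symm z) (∑ i, a i • s i (φ.symm z)) := by
    simp [S, map_sum]
  refine ⟨φ.target ∩ φ.symm ⁻¹' U, S, (continuousOn_extChartAt_symm q₀).isOpen_inter_preimage
    (isOpen_extChartAt_target q₀) hU, hz₀, inter_subset_left, ?_, ?_, fun z hz => ?_⟩
  · refine ContDiffOn.sum fun i _ => contDiffOn_const.smulRight fun z hz => ?_
    exact (contMDiffAt_chartD_apply (f := φ.symm) (X := fun z => s i (φ.symm z))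
      (((hs i).contMDiffAt (hU.mem_nhds hz.2)).comp z (contMDiffAt_chart_symm hz.1))
      (φ.map_target hz.1)).contDiffAt.contDiffWithinAt
  · rw [injective_iff_map_eq_zero]
    intro a ha
    have hsum := (isInvertible_chartD (φ.map_target hz₀.1)).injective
      (((hS_apply _ _).symm.trans ha).trans (map_zero _).symm)
    exact funext (Fintype.linearIndependent_iff.1 (hspan _ hz₀.2).1 a hsum)
  · ext u
    rw [mem_distributionInChart_iff hz.1, ← (hspan _ hz.2).2]
    constructor
    · rintro ⟨v, hv, rfl⟩
      obtain ⟨a, rfl⟩ := (Submodule.mem_span_range_iff_exists_fun ℝ).1 hv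
      exact ⟨a, hS_apply z a⟩
    · rintro ⟨a, rfl⟩
      exact ⟨_, (Submodule.mem_span_range_iff_exists_fun ℝ).2 ⟨a, rfl⟩, (hS_apply z a).symm⟩

theorem exists_isFoliationBox (hd : IsDistribution F r) (hF : IsInvolutive F) (q₀ : Q) :
    ∃ B, ∃ h : Q → EuclideanSpace ℝ (Fin n), q₀ ∈ B ∧ IsFoliationBox F B h := by
  obtain ⟨Ω, S, hΩ, hq₀, hsub, hS, hinj, hrange⟩ := hd.exists_frame_inChart q₀
  obtain ⟨B, -, h, hq₀B, hB⟩ := ((hF.isInvolutiveOn_distributionInChart q₀).congr_mono hsub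
    fun _ _ => rfl).exists_isFoliationBox hΩ hq₀ hS hinj hrange
  exact ⟨(extChartAt (𝓡 n) q₀).source ∩ extChartAt (𝓡 n) q₀ ⁻¹' B, _,
    ⟨mem_extChartAt_source q₀, hq₀B⟩, hB.comp_chart⟩

end ManifoldFrobenius

/-! ### Leaves of involutive distributions -/

section Leaves

theorem eventually_eq_of_countable_image {X Y : Type*} [TopologicalSpace X]
    [LocallyConnectedSpace X] [MetricSpace Y] {f : X → Y} {N : Set X} {x : X} (hN : N ∈ 𝓝 x)
    (hf : ContinuousOn f N) (hcount : (f '' N).Countable) : ∀ᶠ y in 𝓝 x, f y = f x := by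
  obtain ⟨U, ⟨hUo, hxU, hU⟩, hUN⟩ := (LocallyConnectedSpace.open_connected_basis x).mem_iff.1 hN
  have hsub := (hcount.mono (image_mono hUN)).isTotallyDisconnected _ Subset.rfl
    (hU.isPreconnected.image f (hf.mono hUN))
  filter_upwards [hUo.mem_nhds hxU] with y hy using hsub ⟨y, hy, rfl⟩ ⟨x, hxU, rfl⟩

variable {n r : ℕ} {Q : Type*} [TopologicalSpace Q] [ChartedSpace (EuclideanSpace ℝ (Fin n)) Q]
  {F : ∀ q : Q, Submodule ℝ (TangentSpace (𝓡 n) q)}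

theorem IsTangentWithinAt.mono {c : ℝ → Q} {s s' : Set ℝ} {t : ℝ}
    (hc : IsTangentWithinAt F c s t) (hs : s' ⊆ s) : IsTangentWithinAt F c s' t :=
  hc.imp fun _ hv => ⟨hv.1.mono hs, hv.2⟩

namespace IsFoliationBox

variable {B B' : Set Q} {h h' : Q → EuclideanSpace ℝ (Fin n)}

theorem eq_of_isTangentWithinAt (H : IsFoliationBox F B h) {c : ℝ → Q} {J : Set ℝ}
    (hJ : Convex ℝ J) (hcB : ∀ t ∈ J, c t ∈ B) (hc : ∀ t ∈ J, IsTangentWithinAt F c J t)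
    {a b : ℝ} (ha : a ∈ J) (hb : b ∈ J) : h (c b) = h (c a) := by
  have hnorm := hJ.norm_image_sub_le_of_norm_hasDerivWithin_le (C := 0)
    (fun t ht => H.hasDerivWithinAt_zero c J t (hc t ht) (hcB t ht)) (fun _ _ => by simp) ha hb
  rw [zero_mul] at hnorm
  exact sub_eq_zero.1 (norm_le_zero_iff.1 hnorm)

theorem eventually_eq_of_isTangentWithinAt (H : IsFoliationBox F B h) {c : ℝ → Q} {J : Set ℝ}
    (hJ : Convex ℝ J) (hc : ∀ t ∈ J, IsTangentWithinAt F c J t) {t : ℝ} (ht : t ∈ J)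
    (htB : c t ∈ B) : ∀ᶠ x in 𝓝[J] t, c x ∈ B ∧ h (c x) = h (c t) := by
  obtain ⟨_, hv, -⟩ := hc t ht
  obtain ⟨δ, hδ, hsub⟩ := Metric.mem_nhdsWithin_iff.1
    (hv.continuousWithinAt.eventually (H.isOpen.mem_nhds htB))
  filter_upwards [inter_mem_nhdsWithin J (Metric.ball_mem_nhds t hδ)] with x hx
  exact ⟨hsub ⟨hx.2, hx.1⟩, H.eq_of_isTangentWithinAt ((convex_ball t δ).inter hJ)
    (fun s hs => hsub hs) (fun s hs => (hc s hs.2).mono inter_subset_right)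
    ⟨Metric.mem_ball_self hδ, ht⟩ ⟨hx.2, hx.1⟩⟩

theorem eventually_eq (H : IsFoliationBox F B h) (H' : IsFoliationBox F B' h') {p : Q}
    (hp : p ∈ B) (hp' : p ∈ B') : ∀ᶠ p' in 𝓝 p, h p' = h p → h' p' = h' p := by
  obtain ⟨N, hN, hcurve⟩ := H.exists_curve p hp B' (H'.isOpen.mem_nhds hp')
  filter_upwards [hN] with p' hp'N heq
  obtain ⟨c, rfl, rfl, hc⟩ := hcurve p' hp'N heq
  exact H'.eq_of_isTangentWithinAt (convex_Icc 0 1) (fun t ht => (hc t ht).1)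
    (fun t ht => (hc t ht).2) (by simp) (by simp)

end IsFoliationBox

/-- A set is thin if it meets only countably many plaques of each foliation box, a plaque being a
level set of the first integral of the box. -/
def IsThin (F : ∀ q : Q, Submodule ℝ (TangentSpace (𝓡 n) q)) (L : Set Q) : Prop :=
  ∀ (B : Set Q) (h : Q → EuclideanSpace ℝ (Fin n)), IsFoliationBox F B h → (h '' (L ∩ B)).Countable

theorem isThin_singleton (q : Q) : IsThin F {q} := fun _ _ _ =>
  ((countable_singleton q).mono inter_subset_left).image _

theorem IsThin.iUnion {ι : Sort*} [Countable ι] {L : ι → Set Q} (hL : ∀ i, IsThin F (L i)) :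
    IsThin F (⋃ i, L i) := by
  intro B h H
  rw [iUnion_inter, image_iUnion]
  exact countable_iUnion fun i => hL i B h H

theorem IsThin.biUnion {ι : Type*} {s : Set ι} (hs : s.Countable) {L : ι → Set Q}
    (hL : ∀ i ∈ s, IsThin F (L i)) : IsThin F (⋃ i ∈ s, L i) := by
  rw [biUnion_eq_iUnion]
  have := hs.to_subtype
  exact IsThin.iUnion fun i => hL i i.2

theorem IsFoliationBox.isThin_plaque [SecondCountableTopology Q] {B : Set Q}
    {h : Q → EuclideanSpace ℝ (Fin n)} (H : IsFoliationBox F B h) (e : EuclideanSpace ℝ (Fin n)) :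
    IsThin F {p | p ∈ B ∧ h p = e} := by
  intro B' h' H'
  have hN : ∀ p ∈ {p | p ∈ B ∧ h p = e} ∩ B',
      {p' | h p' = h p → h' p' = h' p} ∈ 𝓝[{p | p ∈ B ∧ h p = e} ∩ B'] p := fun p hp =>
    mem_nhdsWithin_of_mem_nhds (H.eventually_eq H' hp.1.1 hp.2)
  obtain ⟨t, hts, htc, hcov⟩ := TopologicalSpace.countable_cover_nhdsWithin hN
  refine (htc.image h').mono ?_
  rintro _ ⟨p, hp, rfl⟩
  obtain ⟨x, hx, hpx⟩ := mem_iUnion₂.1 (hcov hp)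
  exact ⟨x, hx, (hpx (hp.1.2.trans (hts hx).1.2.symm)).symm⟩

theorem exists_isThin_saturated [SecondCountableTopology Q] {ι : Type*} {B : ι → Set Q}
    {h : ι → Q → EuclideanSpace ℝ (Fin n)} (H : ∀ i, IsFoliationBox F (B i) (h i))
    {I : Set ι} (hI : I.Countable) (q : Q) :
    ∃ L : Set Q, q ∈ L ∧ IsThin F L ∧
      ∀ i ∈ I, ∀ p ∈ B i, ∀ p' ∈ B i, h i p' = h i p → p ∈ L → p' ∈ L := by
  let sat : Set Q → Set Q := fun L => ⋃ i ∈ I, ⋃ e ∈ h i '' (L ∩ B i), {p | p ∈ B i ∧ h i p = e}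
  have hsat : ∀ L, IsThin F L → IsThin F (sat L) := fun L hL =>
    IsThin.biUnion hI fun i _ => IsThin.biUnion (hL _ _ (H i)) fun e _ => (H i).isThin_plaque e
  have hiter : ∀ N, IsThin F (sat^[N] {q}) := by
    intro N
    induction N with
    | zero => exact isThin_singleton q
    | succ N ih =>
      rw [Function.iterate_succ_apply']
      exact hsat _ ih
  refine ⟨⋃ N, sat^[N] {q}, mem_iUnion.2 ⟨0, rfl⟩, IsThin.iUnion hiter, ?_⟩
  intro i hi p hp p' hp' heq hpL
  obtain ⟨N, hN⟩ := mem_iUnion.1 hpL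
  refine mem_iUnion.2 ⟨N + 1, ?_⟩
  rw [Function.iterate_succ_apply']
  exact mem_iUnion₂.2 ⟨i, hi, mem_iUnion₂.2 ⟨h i p, ⟨p, ⟨hN, hp⟩, rfl⟩, hp', heq⟩⟩

theorem SmoothlyReachable.mem_iff {L : Set Q} {ι : Type*} {B : ι → Set Q}
    {h : ι → Q → EuclideanSpace ℝ (Fin n)} (H : ∀ i, IsFoliationBox F (B i) (h i))
    (hcov : ∀ p, ∃ i, p ∈ B i)
    (hL : ∀ i, ∀ p ∈ B i, ∀ p' ∈ B i, h i p' = h i p → p ∈ L → p' ∈ L) {p p' : Q}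
    (hpp' : SmoothlyReachable F p p') : p ∈ L ↔ p' ∈ L := by
  obtain ⟨a, b, c, hab, hc, hcF, rfl, rfl⟩ := hpp'
  have htangent : ∀ t ∈ Icc a b, IsTangentWithinAt F c (Icc a b) t := fun t ht =>
    ⟨_, (hc.mdifferentiableOn (by simp) t ht).hasMFDerivWithinAt, hcF t ht⟩
  refine isPreconnected_Icc.induction₂ (s := Icc a b) (fun x y => c x ∈ L ↔ c y ∈ L) ?_
    (fun x y z _ _ _ hxy hyz => hxy.trans hyz) (fun x y _ _ h => h.symm) (left_mem_Icc.2 hab.le)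
    (right_mem_Icc.2 hab.le)
  intro t ht
  obtain ⟨i, hi⟩ := hcov (c t)
  filter_upwards [(H i).eventually_eq_of_isTangentWithinAt (convex_Icc a b) htangent ht hi]
    with x ⟨hxB, heq⟩
  exact ⟨hL i _ hi _ hxB heq, hL i _ hxB _ hi heq.symm⟩

theorem exists_isThin_of_reachable [SecondCountableTopology Q]
    (hbox : ∀ q : Q, ∃ B, ∃ h : Q → EuclideanSpace ℝ (Fin n), q ∈ B ∧ IsFoliationBox F B h)
    (q : Q) :
    ∃ L : Set Q, q ∈ L ∧ IsThin F L ∧ ∀ p p', Reachable F p p' → (p ∈ L ↔ p' ∈ L) := by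
  choose B h hmem H using hbox
  obtain ⟨I, hI, hcov⟩ := TopologicalSpace.countable_cover_nhds
    fun q => (H q).isOpen.mem_nhds (hmem q)
  obtain ⟨L, hqL, hL, hsat⟩ := exists_isThin_saturated H hI q
  refine ⟨L, hqL, hL, fun p p' hpp' => ?_⟩
  induction hpp' with
  | refl => exact Iff.rfl
  | tail _ hstep ih =>
    refine ih.trans (hstep.mem_iff (ι := I) (fun i => H i) (fun p => ?_) fun i => hsat i i.2)
    obtain ⟨i, hi, hp⟩ := mem_iUnion₂.1 (hcov ▸ mem_univ p)
    exact ⟨⟨i, hi⟩, hp⟩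

theorem mem_of_eventually_reachable [IsManifold (𝓡 n) ∞ Q] [SecondCountableTopology Q]
    (hd : IsDistribution F r) (hF : IsInvolutive F) {q : Q} {c : ℝ → Q} {t : ℝ}
    {v : ℝ →L[ℝ] TangentSpace (𝓡 n) (c t)} (hv : HasMFDerivAt 𝓘(ℝ, ℝ) (𝓡 n) c t v)
    (hc : ∀ᶠ s in 𝓝 t, ContinuousAt c s)
    (hr : ∀ᶠ s in 𝓝 t, Reachable F q (c s) ∨ Reachable F (c s) q) : v 1 ∈ F (c t) := by
  have hbox := exists_isFoliationBox hd hF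
  obtain ⟨L, hqL, hL, hreach⟩ := exists_isThin_of_reachable hbox q
  obtain ⟨B, h, hB, H⟩ := hbox (c t)
  have hnear := hc.and (hr.and (hv.continuousAt.eventually (H.isOpen.mem_nhds hB)))
  refine H.tangent c t v hv hB (eventually_eq_of_countable_image hnear (fun s hs => ?_)
    ((hL B h H).mono ?_))
  · exact (H.continuousOn.continuousAt (H.isOpen.mem_nhds hs.2.2)).comp_continuousWithinAt
      hs.1.continuousWithinAt
  · rintro _ ⟨s, ⟨-, hs, hsB⟩, rfl⟩
    exact ⟨c s, ⟨hs.elim (fun h => (hreach _ _ h).1 hqL) fun h => (hreach _ _ h).2 hqL, hsB⟩, rfl⟩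

end Leaves

/-! ### Maps and one-forms in charts -/

section InCharts

variable {m n : ℕ}
  {M : Type*} [TopologicalSpace M] [ChartedSpace (EuclideanSpace ℝ (Fin m)) M]
  {Q : Type*} [TopologicalSpace Q] [ChartedSpace (EuclideanSpace ℝ (Fin n)) Q]

/-- The expression of `f` in the charts at `x₀` and `f x₀`. It has junk values off
`inChartsDomain f x₀`. -/
def inCharts (f : M → Q) (x₀ : M) (z : EuclideanSpace ℝ (Fin m)) : EuclideanSpace ℝ (Fin n) :=
  extChartAt (𝓡 n) (f x₀) (f ((extChartAt (𝓡 m) x₀).symm z))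

/-- The domain of the expression of `f` in charts. -/
def inChartsDomain (f : M → Q) (x₀ : M) : Set (EuclideanSpace ℝ (Fin m)) :=
  {z | z ∈ (extChartAt (𝓡 m) x₀).target ∧
    f ((extChartAt (𝓡 m) x₀).symm z) ∈ (extChartAt (𝓡 n) (f x₀)).source}

/-- A (not necessarily smooth) section of the pullback `f^*(T^*Q)`: the counterpart, for covectors,
of a vector field along `f`. -/
abbrev CovectorAlong (n : ℕ) {M Q : Type*} [TopologicalSpace Q]
    [ChartedSpace (EuclideanSpace ℝ (Fin n)) Q] (f : M → Q) :=
  ∀ x : M, TangentSpace (𝓡 n) (f x) →L[ℝ] ℝ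

variable {f : M → Q}

/-- The one-form `ℓ ∘ Tf`. -/
def CovectorAlong.toOneForm (ℓ : CovectorAlong n f) : OneForm m M :=
  fun x => (ℓ x).comp (mfderiv (𝓡 m) (𝓡 n) f x)

/-- The expression of `ℓ` in the charts at `x₀` and `f x₀`. -/
def CovectorAlong.inChart (ℓ : CovectorAlong n f) (x₀ : M) (z : EuclideanSpace ℝ (Fin m)) :
    EuclideanSpace ℝ (Fin n) →L[ℝ] ℝ :=
  (ℓ ((extChartAt (𝓡 m) x₀).symm z)).comp
    (chartSymmD (f x₀) (extChartAt (𝓡 n) (f x₀) (f ((extChartAt (𝓡 m) x₀).symm z))))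

/-- The derivative `(u, a) ↦ (D_u ℓ)(a)` of `ℓ` at `x₀`, computed in the charts at `x₀` and
`f x₀`. -/
def CovectorAlong.chartDeriv (ℓ : CovectorAlong n f) (x₀ : M) :
    TangentSpace (𝓡 m) x₀ →L[ℝ] TangentSpace (𝓡 n) (f x₀) →L[ℝ] ℝ :=
  fderiv ℝ (ℓ.inChart (m := m) x₀) (extChartAt (𝓡 m) x₀ x₀)

theorem inChartsDomain_mem_nhds {x₀ : M} (hf : ContinuousAt f x₀) :
    inChartsDomain (m := m) (n := n) f x₀ ∈ 𝓝 (extChartAt (𝓡 m) x₀ x₀) := by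
  have hcomp : ContinuousAt (f ∘ (extChartAt (𝓡 m) x₀).symm) (extChartAt (𝓡 m) x₀ x₀) :=
    ContinuousAt.comp (by rwa [extChartAt_to_inv]) (continuousAt_extChartAt_symm x₀)
  refine Filter.inter_mem (extChartAt_target_mem_nhds x₀) (hcomp.preimage_mem_nhds ?_)
  rw [Function.comp_apply, extChartAt_to_inv]
  exact extChartAt_source_mem_nhds (f x₀)

variable [IsManifold (𝓡 m) ∞ M] {x₀ : M} {z : EuclideanSpace ℝ (Fin m)}

theorem chartD_self_apply (u : EuclideanSpace ℝ (Fin m)) : chartD x₀ x₀ u = u :=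
  congrArg (fun L : EuclideanSpace ℝ (Fin m) →L[ℝ] EuclideanSpace ℝ (Fin m) => L u) chartD_self

theorem chartSymmD_self_apply (u : EuclideanSpace ℝ (Fin m)) :
    chartSymmD x₀ (extChartAt (𝓡 m) x₀ x₀) u = u :=
  (congrArg (chartSymmD x₀ _) (chartD_self_apply u).symm).trans
    (chartSymmD_chartD (mem_extChartAt_source x₀) u)

theorem OneForm.IsSmooth.contDiffAt_inChart {θ : OneForm m M} (hθ : θ.IsSmooth)
    (hz : z ∈ (extChartAt (𝓡 m) x₀).target) : ContDiffAt ℝ ∞ (θ.inChart x₀) z := by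
  have hopen := isOpen_extChartAt_target (I := 𝓡 m) x₀
  suffices h : ContDiffOn ℝ ∞ (θ.inChart x₀) (extChartAt (𝓡 m) x₀).target from
    h.contDiffAt (hopen.mem_nhds hz)
  rw [contDiffOn_clm_apply]
  intro w z hz
  refine ContMDiffAt.contDiffAt ?_ |>.contDiffWithinAt
  have htangentMap : ContMDiffOn 𝓘(ℝ, EuclideanSpace ℝ (Fin m)).tangent (𝓡 m).tangent ∞ _ _ :=
    ContMDiffOn.contMDiffOn_tangentMapWithin
      (f := (extChartAt (𝓡 m) x₀).symm) (I' := 𝓡 m) (s := (extChartAt (𝓡 m) x₀).target) (m := ∞)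
      (n := ∞) (I := 𝓘(ℝ, EuclideanSpace ℝ (Fin m)))
      (fun x hx => (contMDiffAt_chart_symm hx).contMDiffWithinAt) le_rfl hopen.uniqueMDiffOn
  have htangentMap_at := htangentMap.contMDiffAt
    (x := (⟨z, w⟩ : TangentBundle 𝓘(ℝ, EuclideanSpace ℝ (Fin m)) (EuclideanSpace ℝ (Fin m))))
    ((hopen.preimage (FiberBundle.continuous_proj _ _)).mem_nhds hz)
  have hconst : ContMDiffAt 𝓘(ℝ, EuclideanSpace ℝ (Fin m)) 𝓘(ℝ, EuclideanSpace ℝ (Fin m)).tangent ∞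
      (fun z => (⟨z, w⟩ : TangentBundle 𝓘(ℝ, EuclideanSpace ℝ (Fin m))
        (EuclideanSpace ℝ (Fin m)))) z :=
    contMDiffAt_vectorSpace_iff_contDiffAt.2 contDiffAt_const
  refine (hθ.contMDiffAt.comp z (htangentMap_at.comp z hconst)).congr_of_eventuallyEq ?_
  filter_upwards [hopen.mem_nhds hz] with y hy
  change θ ((extChartAt (𝓡 m) x₀).symm y) (chartSymmD x₀ y w) =
    θ ((extChartAt (𝓡 m) x₀).symm y) (mfderivWithin _ _ _ _ _ _)
  rw [mfderivWithin_of_isOpen hopen hy]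
  rfl

namespace OneForm

theorem d_eq (θ : OneForm m M) (x : M) (a b : EuclideanSpace ℝ (Fin m)) :
    θ.d x a b = fderiv ℝ (θ.inChart x) (extChartAt (𝓡 m) x x) a b -
      fderiv ℝ (θ.inChart x) (extChartAt (𝓡 m) x x) b a := by
  change fderiv ℝ (θ.inChart x) (extChartAt (𝓡 m) x x) (chartD x x a) (chartD x x b) -
    fderiv ℝ (θ.inChart x) (extChartAt (𝓡 m) x x) (chartD x x b) (chartD x x a) = _
  rw [chartD_self_apply, chartD_self_apply]

theorem d_add {θ θ' : OneForm m M} {x : M}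
    (hθ : DifferentiableAt ℝ (θ.inChart x) (extChartAt (𝓡 m) x x))
    (hθ' : DifferentiableAt ℝ (θ'.inChart x) (extChartAt (𝓡 m) x x))
    (a b : EuclideanSpace ℝ (Fin m)) :
    OneForm.d (θ + θ') x a b = θ.d x a b + θ'.d x a b := by
  have hadd : OneForm.inChart (θ + θ') x = θ.inChart x + θ'.inChart x :=
    funext fun _ => ContinuousLinearMap.add_comp _ _ _
  simp only [d_eq, hadd, fderiv_add hθ hθ', add_apply]
  ring

theorem d_neg (θ : OneForm m M) (x : M) (a b : EuclideanSpace ℝ (Fin m)) :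
    OneForm.d (-θ) x a b = -θ.d x a b := by
  have hneg : OneForm.inChart (-θ) x = -θ.inChart x :=
    funext fun _ => ContinuousLinearMap.neg_comp _ _
  simp only [d_eq, hneg, fderiv_neg, neg_apply]
  ring

end OneForm

variable [IsManifold (𝓡 n) ∞ Q]

theorem contDiffAt_inCharts (hf : ContMDiff (𝓡 m) (𝓡 n) ∞ f)
    (hz : z ∈ inChartsDomain (n := n) f x₀) : ContDiffAt ℝ ∞ (inCharts (n := n) f x₀) z :=
  ((contMDiffAt_chart hz.2).comp z
    (hf.contMDiffAt.comp z (contMDiffAt_chart_symm hz.1))).contDiffAt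

theorem fderiv_inCharts_apply (hf : ContMDiff (𝓡 m) (𝓡 n) ∞ f)
    (hz : z ∈ inChartsDomain (n := n) f x₀) (u : EuclideanSpace ℝ (Fin m)) :
    fderiv ℝ (inCharts (n := n) f x₀) z u =
      chartD (f x₀) (f ((extChartAt (𝓡 m) x₀).symm z))
        (mfderiv (𝓡 m) (𝓡 n) f ((extChartAt (𝓡 m) x₀).symm z) (chartSymmD x₀ z u)) := by
  have hfx := (hf.mdifferentiableAt (by simp) :
    MDifferentiableAt (𝓡 m) (𝓡 n) f ((extChartAt (𝓡 m) x₀).symm z)).hasMFDerivAt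
  have hderiv : HasFDerivAt (inCharts (n := n) f x₀)
      ((chartD (f x₀) (f ((extChartAt (𝓡 m) x₀).symm z))).comp
        ((mfderiv (𝓡 m) (𝓡 n) f ((extChartAt (𝓡 m) x₀).symm z)).comp (chartSymmD x₀ z)) :
        EuclideanSpace ℝ (Fin m) →L[ℝ] EuclideanSpace ℝ (Fin n)) z :=
    (HasMFDerivAt.comp z (hasMFDerivAt_chart hz.2)
      (HasMFDerivAt.comp z hfx (hasMFDerivAt_chart_symm hz.1))).hasFDerivAt
  exact congrArg (fun L : EuclideanSpace ℝ (Fin m) →L[ℝ] EuclideanSpace ℝ (Fin n) => L u)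
    hderiv.fderiv

theorem chartSymmD_fderiv_inCharts (hf : ContMDiff (𝓡 m) (𝓡 n) ∞ f)
    (hz : z ∈ inChartsDomain (n := n) f x₀) (u : EuclideanSpace ℝ (Fin m)) :
    chartSymmD (f x₀) (extChartAt (𝓡 n) (f x₀) (f ((extChartAt (𝓡 m) x₀).symm z)))
      (fderiv ℝ (inCharts (n := n) f x₀) z u) =
      mfderiv (𝓡 m) (𝓡 n) f ((extChartAt (𝓡 m) x₀).symm z) (chartSymmD x₀ z u) := by
  rw [fderiv_inCharts_apply hf hz]
  exact chartSymmD_chartD hz.2 _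

theorem fderiv_inCharts_self (hf : ContMDiff (𝓡 m) (𝓡 n) ∞ f) (u : EuclideanSpace ℝ (Fin m)) :
    fderiv ℝ (inCharts (n := n) f x₀) (extChartAt (𝓡 m) x₀ x₀) u = mfderiv (𝓡 m) (𝓡 n) f x₀ u := by
  have hz := mem_of_mem_nhds (inChartsDomain_mem_nhds (m := m) (n := n)
    (hf.continuous.continuousAt (x := x₀)))
  rw [fderiv_inCharts_apply hf hz, chartSymmD_self_apply, extChartAt_to_inv]
  exact chartD_self_apply _

theorem fderiv_comp_fderiv_sub_swap {E G : Type*} [NormedAddCommGroup E] [NormedSpace ℝ E]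
    [NormedAddCommGroup G] [NormedSpace ℝ G] {μ : E → G →L[ℝ] ℝ} {g : E → G} {z : E}
    (hμ : DifferentiableAt ℝ μ z) (hg : ContDiffAt ℝ 2 g z) (a b : E) :
    fderiv ℝ (fun y => (μ y).comp (fderiv ℝ g y)) z a b -
        fderiv ℝ (fun y => (μ y).comp (fderiv ℝ g y)) z b a =
      fderiv ℝ μ z a (fderiv ℝ g z b) - fderiv ℝ μ z b (fderiv ℝ g z a) := by
  have hg' : DifferentiableAt ℝ (fderiv ℝ g) z :=
    (hg.fderiv_right (m := 1) (by norm_num)).differentiableAt (by simp)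
  have hsymm : fderiv ℝ (fderiv ℝ g) z a b = fderiv ℝ (fderiv ℝ g) z b a :=
    (hg.isSymmSndFDerivAt (by rw [minSmoothness_of_isRCLikeNormedField])) a b
  rw [fderiv_clm_comp hμ hg']
  simp [hsymm]

namespace CovectorAlong

variable {ℓ : CovectorAlong n f}

theorem toOneForm_inChart_eventuallyEq (hf : ContMDiff (𝓡 m) (𝓡 n) ∞ f) :
    ℓ.toOneForm.inChart x₀ =ᶠ[𝓝 (extChartAt (𝓡 m) x₀ x₀)]
      fun z => (ℓ.inChart x₀ z).comp (fderiv ℝ (inCharts (n := n) f x₀) z) := by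
  filter_upwards [inChartsDomain_mem_nhds (m := m) (n := n)
    (hf.continuous.continuousAt (x := x₀))] with z hz
  ext u
  exact congrArg (ℓ _) (chartSymmD_fderiv_inCharts hf hz u).symm

theorem differentiableAt_toOneForm_inChart (hf : ContMDiff (𝓡 m) (𝓡 n) ∞ f)
    (hℓ : DifferentiableAt ℝ (ℓ.inChart x₀) (extChartAt (𝓡 m) x₀ x₀)) :
    DifferentiableAt ℝ (ℓ.toOneForm.inChart x₀) (extChartAt (𝓡 m) x₀ x₀) := by
  have hz := mem_of_mem_nhds (inChartsDomain_mem_nhds (m := m) (n := n)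
    (hf.continuous.continuousAt (x := x₀)))
  exact (hℓ.clm_comp (((contDiffAt_inCharts hf hz).fderiv_right (m := ∞) le_rfl).differentiableAt
    (by simp))).congr_of_eventuallyEq (toOneForm_inChart_eventuallyEq hf)

theorem d_toOneForm (hf : ContMDiff (𝓡 m) (𝓡 n) ∞ f)
    (hℓ : DifferentiableAt ℝ (ℓ.inChart x₀) (extChartAt (𝓡 m) x₀ x₀))
    (a b : EuclideanSpace ℝ (Fin m)) :
    ℓ.toOneForm.d x₀ a b = ℓ.chartDeriv x₀ a (mfderiv (𝓡 m) (𝓡 n) f x₀ b) -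
      ℓ.chartDeriv x₀ b (mfderiv (𝓡 m) (𝓡 n) f x₀ a) := by
  have hz := mem_of_mem_nhds (inChartsDomain_mem_nhds (m := m) (n := n)
    (hf.continuous.continuousAt (x := x₀)))
  rw [OneForm.d_eq, (toOneForm_inChart_eventuallyEq hf).fderiv_eq,
    fderiv_comp_fderiv_sub_swap hℓ
      ((contDiffAt_inCharts hf hz).of_le (WithTop.coe_le_coe.2 le_top)),
    fderiv_inCharts_self hf, fderiv_inCharts_self hf]
  rfl

theorem mfderiv_apply_extendVector
    (hℓ : DifferentiableAt ℝ (ℓ.inChart x₀) (extChartAt (𝓡 m) x₀ x₀))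
    (a : EuclideanSpace ℝ (Fin n)) (u : EuclideanSpace ℝ (Fin m)) :
    mfderiv (𝓡 m) 𝓘(ℝ, ℝ) (fun x => ℓ x (extendVector (f x₀) a (f x))) x₀ u =
      ℓ.chartDeriv x₀ u a := by
  have happly : HasFDerivAt (fun z => ℓ.inChart x₀ z a)
      ((ContinuousLinearMap.apply ℝ ℝ a).comp
        (fderiv ℝ (ℓ.inChart x₀) (extChartAt (𝓡 m) x₀ x₀))) (extChartAt (𝓡 m) x₀ x₀) :=
    (ContinuousLinearMap.apply ℝ ℝ a).hasFDerivAt.comp _ hℓ.hasFDerivAt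
  have hcomp := HasMFDerivAt.comp x₀ happly.hasMFDerivAt
    (hasMFDerivAt_chart (mem_extChartAt_source (I := 𝓡 m) x₀))
  have heq : (fun x => ℓ x (extendVector (f x₀) a (f x))) =ᶠ[𝓝 x₀]
      (fun z => ℓ.inChart x₀ z a) ∘ extChartAt (𝓡 m) x₀ := by
    filter_upwards [extChartAt_source_mem_nhds (I := 𝓡 m) x₀] with x hx
    change ℓ x (chartSymmD (f x₀) _ (chartD (f x₀) (f x₀) a)) = ℓ.inChart x₀ _ a
    rw [chartD_self_apply, inChart, (extChartAt (𝓡 m) x₀).left_inv hx]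
    rfl
  have hmfderiv := (hcomp.congr_of_eventuallyEq heq).mfderiv
  refine (congrArg (fun L : EuclideanSpace ℝ (Fin m) →L[ℝ] ℝ => L u) hmfderiv).trans ?_
  exact congrArg (fun w => ℓ.chartDeriv x₀ w a) (chartD_self_apply u)

end CovectorAlong

end InCharts

/-! ### The discrete two-forms -/

section Forms

variable {n : ℕ} {V Q : Type*}
  [TopologicalSpace V] [ChartedSpace (EuclideanSpace ℝ (Fin (2 * n))) V]
  [TopologicalSpace Q] [ChartedSpace (EuclideanSpace ℝ (Fin n)) Q]

namespace DiscreteTangentBundle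

variable (B : DiscreteTangentBundle n V Q)

theorem liftPlus_add_liftMinus (v : V) (a : TangentSpace (𝓡 (2 * n)) v) :
    B.liftPlus v (B.Tplus v a) + B.liftMinus v (B.Tminus v a) = a := by
  refine (B.Tboth_isInvertible v).injective (Prod.ext ?_ ?_)
  · change B.Tplus v _ = B.Tplus v a
    rw [map_add, B.Tplus_liftPlus, B.Tplus_liftMinus, add_zero]
  · change B.Tminus v _ = B.Tminus v a
    rw [map_add, B.Tminus_liftPlus, B.Tminus_liftMinus, zero_add]

/-- The covector `δq ↦ σ(v)δq⁺` along `∂⁺`. -/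
def covectorPlus (σ : OneForm (2 * n) V) : CovectorAlong n B.plus :=
  fun v => (σ v).comp (B.liftPlus v)

/-- The covector `δq ↦ σ(v)δq⁻` along `∂⁻`. -/
def covectorMinus (σ : OneForm (2 * n) V) : CovectorAlong n B.minus :=
  fun v => (σ v).comp (B.liftMinus v)

theorem thetaPlus_eq (σ : OneForm (2 * n) V) : B.thetaPlus σ = (B.covectorPlus σ).toOneForm :=
  rfl

theorem thetaMinus_eq (σ : OneForm (2 * n) V) : B.thetaMinus σ = -(B.covectorMinus σ).toOneForm :=
  rfl

theorem toOneForm_covectorPlus_add_toOneForm_covectorMinus (σ : OneForm (2 * n) V) :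
    (B.covectorPlus σ).toOneForm + (B.covectorMinus σ).toOneForm = σ := by
  funext v
  ext a
  exact (map_add (σ v) _ _).symm.trans (congrArg (σ v) (B.liftPlus_add_liftMinus v a))

/-- The expression of `T∂^±` in charts. -/
def TbothInCharts (v : V) (z : EuclideanSpace ℝ (Fin (2 * n))) :
    EuclideanSpace ℝ (Fin (2 * n)) →L[ℝ] EuclideanSpace ℝ (Fin n) × EuclideanSpace ℝ (Fin n) :=
  (fderiv ℝ (inCharts B.plus v) z).prod (fderiv ℝ (inCharts B.minus v) z)

/-- The common domain of the expressions of `∂⁺` and `∂⁻` in charts. -/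
def chartDomain (v : V) : Set (EuclideanSpace ℝ (Fin (2 * n))) :=
  inChartsDomain (n := n) B.plus v ∩ inChartsDomain (n := n) B.minus v

theorem chartDomain_mem_nhds (v : V) :
    B.chartDomain v ∈ 𝓝 (extChartAt (𝓡 (2 * n)) v v) :=
  Filter.inter_mem (inChartsDomain_mem_nhds B.submersion_plus.contMDiff.continuous.continuousAt)
    (inChartsDomain_mem_nhds B.submersion_minus.contMDiff.continuous.continuousAt)

variable [IsManifold (𝓡 (2 * n)) ∞ V] [IsManifold (𝓡 n) ∞ Q] {v : V}
  {z : EuclideanSpace ℝ (Fin (2 * n))}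

theorem isInvertible_TbothInCharts (hz : z ∈ B.chartDomain v) :
    (B.TbothInCharts v z).IsInvertible := by
  have hinj : Function.Injective (B.TbothInCharts v z).toLinearMap := by
    rw [← LinearMap.ker_eq_bot, LinearMap.ker_eq_bot']
    intro w hw
    have hplus := chartSymmD_fderiv_inCharts B.submersion_plus.contMDiff hz.1 w
    have hminus := chartSymmD_fderiv_inCharts B.submersion_minus.contMDiff hz.2 w
    rw [show fderiv ℝ (inCharts B.plus v) z w = 0 from congrArg Prod.fst hw, map_zero] at hplus
    rw [show fderiv ℝ (inCharts B.minus v) z w = 0 from congrArg Prod.snd hw, map_zero] at hminus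
    rw [← chartD_chartSymmD hz.1.1 w, B.ker_inf_ker _ _ hplus.symm hminus.symm, map_zero]
  have hfin : Module.finrank ℝ (EuclideanSpace ℝ (Fin (2 * n))) =
      Module.finrank ℝ (EuclideanSpace ℝ (Fin n) × EuclideanSpace ℝ (Fin n)) := by
    simp [two_mul]
  exact ⟨(LinearEquiv.ofInjectiveOfFinrankEq _ hinj hfin).toContinuousLinearEquiv, rfl⟩

theorem contDiffAt_TbothInCharts (hz : z ∈ B.chartDomain v) :
    ContDiffAt ℝ ∞ (B.TbothInCharts v) z := by
  have hsum : B.TbothInCharts v = fun z =>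
      (ContinuousLinearMap.inl ℝ _ _).comp (fderiv ℝ (inCharts B.plus v) z) +
      (ContinuousLinearMap.inr ℝ _ _).comp (fderiv ℝ (inCharts B.minus v) z) := by
    funext z
    ext u <;> simp [TbothInCharts]
  rw [hsum]
  exact (contDiffAt_const.clm_comp
    ((contDiffAt_inCharts B.submersion_plus.contMDiff hz.1).fderiv_right (m := ∞) le_rfl)).add
    (contDiffAt_const.clm_comp
      ((contDiffAt_inCharts B.submersion_minus.contMDiff hz.2).fderiv_right (m := ∞) le_rfl))

theorem differentiableAt_inverse_TbothInCharts (hz : z ∈ B.chartDomain v) :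
    DifferentiableAt ℝ (fun y => (B.TbothInCharts v y).inverse) z :=
  (((B.isInvertible_TbothInCharts hz).contDiffAt_map_inverse (n := ∞)).comp z
    (B.contDiffAt_TbothInCharts hz)).differentiableAt (by simp)

theorem chartSymmD_inverse_TbothInCharts (hz : z ∈ B.chartDomain v)
    (w : EuclideanSpace ℝ (Fin n) × EuclideanSpace ℝ (Fin n)) :
    chartSymmD v z ((B.TbothInCharts v z).inverse w) =
      (B.Tboth ((extChartAt (𝓡 (2 * n)) v).symm z)).inverse
        (chartSymmD (B.plus v) (extChartAt (𝓡 n) (B.plus v)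
            (B.plus ((extChartAt (𝓡 (2 * n)) v).symm z))) w.1,
          chartSymmD (B.minus v) (extChartAt (𝓡 n) (B.minus v)
            (B.minus ((extChartAt (𝓡 (2 * n)) v).symm z))) w.2) := by
  have hinv := (B.isInvertible_TbothInCharts hz).self_apply_inverse w
  apply (B.Tboth_isInvertible _).injective
  rw [B.Tboth_inverse_apply]
  refine Prod.ext ?_ ?_
  · rw [show w.1 = fderiv ℝ (inCharts B.plus v) z _ from (congrArg Prod.fst hinv).symm]
    exact (chartSymmD_fderiv_inCharts B.submersion_plus.contMDiff hz.1 _).symm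
  · rw [show w.2 = fderiv ℝ (inCharts B.minus v) z _ from (congrArg Prod.snd hinv).symm]
    exact (chartSymmD_fderiv_inCharts B.submersion_minus.contMDiff hz.2 _).symm

variable {σ : OneForm (2 * n) V}

theorem covectorPlus_inChart (hz : z ∈ B.chartDomain v) :
    (B.covectorPlus σ).inChart v z =
      (σ.inChart v z).comp
        ((B.TbothInCharts v z).inverse.comp (ContinuousLinearMap.inl ℝ _ _)) := by
  ext w
  refine (congrArg (σ _) ((B.chartSymmD_inverse_TbothInCharts hz (w, 0)).trans ?_)).symm
  rw [map_zero]
  rfl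

theorem covectorMinus_inChart (hz : z ∈ B.chartDomain v) :
    (B.covectorMinus σ).inChart v z =
      (σ.inChart v z).comp
        ((B.TbothInCharts v z).inverse.comp (ContinuousLinearMap.inr ℝ _ _)) := by
  ext w
  refine (congrArg (σ _) ((B.chartSymmD_inverse_TbothInCharts hz (0, w)).trans ?_)).symm
  rw [map_zero]
  rfl

theorem differentiableAt_covectorPlus_inChart (hσ : σ.IsSmooth) (v : V) :
    DifferentiableAt ℝ ((B.covectorPlus σ).inChart v) (extChartAt (𝓡 (2 * n)) v v) := by
  have hdiff := ((hσ.contDiffAt_inChart (mem_extChartAt_target v)).differentiableAt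
    (by simp)).clm_comp ((B.differentiableAt_inverse_TbothInCharts
      (mem_of_mem_nhds (B.chartDomain_mem_nhds v))).clm_comp
        (differentiableAt_const (ContinuousLinearMap.inl ℝ _ _)))
  refine hdiff.congr_of_eventuallyEq ?_
  filter_upwards [B.chartDomain_mem_nhds v] with z hz using B.covectorPlus_inChart hz

theorem differentiableAt_covectorMinus_inChart (hσ : σ.IsSmooth) (v : V) :
    DifferentiableAt ℝ ((B.covectorMinus σ).inChart v) (extChartAt (𝓡 (2 * n)) v v) := by
  have hdiff := ((hσ.contDiffAt_inChart (mem_extChartAt_target v)).differentiableAt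
    (by simp)).clm_comp ((B.differentiableAt_inverse_TbothInCharts
      (mem_of_mem_nhds (B.chartDomain_mem_nhds v))).clm_comp
        (differentiableAt_const (ContinuousLinearMap.inr ℝ _ _)))
  refine hdiff.congr_of_eventuallyEq ?_
  filter_upwards [B.chartDomain_mem_nhds v] with z hz using B.covectorMinus_inChart hz

theorem omegaPlus_eq_omegaMinus (hσ : σ.IsSmooth) (hclosed : ∀ a b, σ.d v a b = 0)
    (a b : TangentSpace (𝓡 (2 * n)) v) : B.omegaPlus σ v a b = B.omegaMinus σ v a b := by
  have hadd := OneForm.d_add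
    ((B.covectorPlus σ).differentiableAt_toOneForm_inChart B.submersion_plus.contMDiff
      (B.differentiableAt_covectorPlus_inChart hσ v))
    ((B.covectorMinus σ).differentiableAt_toOneForm_inChart B.submersion_minus.contMDiff
      (B.differentiableAt_covectorMinus_inChart hσ v)) a b
  have hneg := OneForm.d_neg (B.covectorMinus σ).toOneForm v a b
  rw [toOneForm_covectorPlus_add_toOneForm_covectorMinus, hclosed] at hadd
  rw [omegaPlus, omegaMinus, thetaPlus_eq, thetaMinus_eq]
  linarith

theorem omegaPlus_eq_chartDeriv (hσ : σ.IsSmooth) (v : V) (a b : TangentSpace (𝓡 (2 * n)) v) :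
    B.omegaPlus σ v a b = (B.covectorPlus σ).chartDeriv v b (B.Tplus v a) -
      (B.covectorPlus σ).chartDeriv v a (B.Tplus v b) := by
  rw [omegaPlus, thetaPlus_eq]
  exact (congrArg Neg.neg (CovectorAlong.d_toOneForm B.submersion_plus.contMDiff
    (B.differentiableAt_covectorPlus_inChart hσ v) a b)).trans (neg_sub _ _)

theorem omegaMinus_eq_chartDeriv (hσ : σ.IsSmooth) (v : V) (a b : TangentSpace (𝓡 (2 * n)) v) :
    B.omegaMinus σ v a b = (B.covectorMinus σ).chartDeriv v a (B.Tminus v b) -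
      (B.covectorMinus σ).chartDeriv v b (B.Tminus v a) := by
  have hneg := OneForm.d_neg (B.covectorMinus σ).toOneForm v a b
  rw [omegaMinus, thetaMinus_eq]
  exact (neg_eq_iff_eq_neg.2 hneg).trans (CovectorAlong.d_toOneForm B.submersion_minus.contMDiff
    (B.differentiableAt_covectorMinus_inChart hσ v) a b)

theorem dpm_eq_chartDeriv (hσ : σ.IsSmooth) (v : V) (a : TangentSpace (𝓡 n) (B.minus v))
    (c : TangentSpace (𝓡 n) (B.plus v)) :
    B.dpm σ v a c = (B.covectorMinus σ).chartDeriv v (B.liftPlus v c) a :=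
  CovectorAlong.mfderiv_apply_extendVector (B.differentiableAt_covectorMinus_inChart hσ v) a _

theorem dpm_zero_left (hσ : σ.IsSmooth) (v : V) (c : TangentSpace (𝓡 n) (B.plus v)) :
    B.dpm σ v 0 c = 0 := by
  rw [B.dpm_eq_chartDeriv hσ, map_zero]

theorem dpm_zero_right (hσ : σ.IsSmooth) (v : V) (a : TangentSpace (𝓡 n) (B.minus v)) :
    B.dpm σ v a 0 = 0 := by
  rw [B.dpm_eq_chartDeriv hσ, map_zero, map_zero]
  rfl

theorem omegaPlus_eq_dpm (hσ : σ.IsSmooth) (hclosed : ∀ a b, σ.d v a b = 0)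
    (a b : TangentSpace (𝓡 (2 * n)) v) : B.omegaPlus σ v a b =
      B.dpm σ v (B.Tminus v b) (B.Tplus v a) - B.dpm σ v (B.Tminus v a) (B.Tplus v b) := by
  set A := (B.covectorMinus σ).chartDeriv (m := 2 * n) v
  have hA : ∀ a b, B.omegaPlus σ v a b = A a (B.Tminus v b) - A b (B.Tminus v a) := fun a b =>
    (B.omegaPlus_eq_omegaMinus hσ hclosed a b).trans (B.omegaMinus_eq_chartDeriv hσ v a b)
  have hsplit : ∀ a w, A a w = A (B.liftPlus v (B.Tplus v a)) w +
      A (B.liftMinus v (B.Tminus v a)) w := fun a w =>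
    (congrArg (fun x => A x w) (B.liftPlus_add_liftMinus v a).symm).trans
      (congrArg (fun L => L w) (map_add A _ _))
  have hvert : B.omegaPlus σ v (B.liftMinus v (B.Tminus v a)) (B.liftMinus v (B.Tminus v b)) =
      0 := by
    rw [B.omegaPlus_eq_chartDeriv hσ, B.Tplus_liftMinus, B.Tplus_liftMinus, map_zero, map_zero,
      sub_zero]
  rw [hA, B.Tminus_liftMinus, B.Tminus_liftMinus] at hvert
  rw [hA, B.dpm_eq_chartDeriv hσ, B.dpm_eq_chartDeriv hσ, hsplit a, hsplit b]
  linarith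

end DiscreteTangentBundle

end Forms

/-! ### Curves in the fibres of submersions -/

section FibreCurves

theorem exists_curve_of_hasStrictFDerivAt {E G : Type*} [NormedAddCommGroup E] [NormedSpace ℝ E]
    [CompleteSpace E] [NormedAddCommGroup G] [NormedSpace ℝ G] [FiniteDimensional ℝ G] {f : E → G}
    {f' : E →L[ℝ] G} {a u : E} (hf : HasStrictFDerivAt f f' a) (hf' : Function.Surjective f')
    (hu : f' u = 0) :
    ∃ α : ℝ → E, α 0 = a ∧ HasDerivAt α u 0 ∧ ∀ᶠ s in 𝓝 0, ContinuousAt α s ∧ f (α s) = f a := by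
  have hrange : f'.range = ⊤ := LinearMap.range_eq_top.2 hf'
  let w : f'.ker := ⟨u, hu⟩
  have hline : HasDerivAt (fun s : ℝ => s • w) w 0 := by
    simpa using (hasDerivAt_id (0 : ℝ)).smul_const w
  have hcont : Continuous (fun s : ℝ => ((f a, s • w) : G × f'.ker)) := by fun_prop
  have hlim : Filter.Tendsto (fun s : ℝ => ((f a, s • w) : G × f'.ker)) (𝓝 0) (𝓝 (f a, 0)) := by
    simpa using hcont.tendsto 0
  refine ⟨fun s => hf.implicitFunction f f' hrange (f a) (s • w), by simp, ?_, ?_⟩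
  · have himplicit : HasFDerivAt (hf.implicitFunction f f' hrange (f a)) f'.ker.subtypeL
        ((0 : ℝ) • w) := by
      rw [zero_smul]
      exact (hf.to_implicitFunction hrange).hasFDerivAt
    exact himplicit.comp_hasDerivAt 0 hline
  · let e := hf.implicitToOpenPartialHomeomorph f f' hrange
    filter_upwards [hlim.eventually (e.open_target.mem_nhds
      (hf.mem_implicitToOpenPartialHomeomorph_target hrange)),
      hlim.eventually (hf.map_implicitFunction_eq hrange)] with s hs hfs
    exact ⟨(e.continuousAt_symm hs).comp (f := fun s : ℝ => ((f a, s • w) : G × f'.ker))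
      hcont.continuousAt, hfs⟩

theorem map_ker_eq_of_finrank_eq {K E G H : Type*} [DivisionRing K] [AddCommGroup E] [Module K E]
    [FiniteDimensional K E] [AddCommGroup G] [Module K G] [AddCommGroup H] [Module K H]
    {A : E →ₗ[K] G} {B : E →ₗ[K] H} {S : Submodule K H} [FiniteDimensional K S]
    (hA : Function.Surjective A) (hAB : Disjoint (LinearMap.ker A) (LinearMap.ker B))
    (hle : (LinearMap.ker A).map B ≤ S)
    (hdim : Module.finrank K E = Module.finrank K G + Module.finrank K S) :
    (LinearMap.ker A).map B = S := by
  have hker : Module.finrank K (LinearMap.ker A) = Module.finrank K S := by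
    have hrank := A.finrank_range_add_finrank_ker
    rw [LinearMap.range_eq_top.2 hA, finrank_top] at hrank
    omega
  have hmap : Module.finrank K (LinearMap.ker A) = Module.finrank K ((LinearMap.ker A).map B) :=
    (LinearEquiv.ofBijective (B.submoduleMap (LinearMap.ker A))
      ⟨LinearMap.submoduleMap_injective_of_injOn (LinearMap.disjoint_ker_iff_injOn.1 hAB),
        B.submoduleMap_surjective _⟩).finrank_eq
  exact Submodule.eq_of_le_of_finrank_eq hle (hmap.symm.trans hker)

variable {m n : ℕ}
  {M : Type*} [TopologicalSpace M] [ChartedSpace (EuclideanSpace ℝ (Fin m)) M]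
  {Q : Type*} [TopologicalSpace Q] [ChartedSpace (EuclideanSpace ℝ (Fin n)) Q]
  [IsManifold (𝓡 m) ∞ M] [IsManifold (𝓡 n) ∞ Q]

theorem IsSmoothSubmersion.exists_curve {f : M → Q} (hf : IsSmoothSubmersion (m := m) (n := n) f)
    {x : M} {u : TangentSpace (𝓡 m) x} (hu : mfderiv (𝓡 m) (𝓡 n) f x u = 0) :
    ∃ (γ : ℝ → M) (v : ℝ →L[ℝ] EuclideanSpace ℝ (Fin m)), γ 0 = x ∧ v 1 = u ∧
      HasMFDerivAt 𝓘(ℝ, ℝ) (𝓡 m) γ 0 v ∧ ∀ᶠ s in 𝓝 0, ContinuousAt γ s ∧ f (γ s) = f x := by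
  have hdomain := inChartsDomain_mem_nhds (m := m) (n := n)
    (hf.contMDiff.continuous.continuousAt (x := x))
  have hx := mem_of_mem_nhds hdomain
  have hfderiv := fderiv_inCharts_self (x₀ := x) hf.contMDiff
  have hsurj : Function.Surjective
      (fderiv ℝ (inCharts (n := n) f x) (extChartAt (𝓡 m) x x)) := fun b =>
    (hf.surjective x b).imp fun a ha => (hfderiv a).trans ha
  obtain ⟨α, hα_zero, hα, hα_fibre⟩ := exists_curve_of_hasStrictFDerivAt
    ((contDiffAt_inCharts hf.contMDiff hx).hasStrictFDerivAt (by simp)) hsurj ((hfderiv u).trans hu)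
  have hα_lim : Filter.Tendsto α (𝓝 0) (𝓝 (extChartAt (𝓡 m) x x)) := by
    rw [← hα_zero]
    exact hα.continuousAt
  refine ⟨fun s => (extChartAt (𝓡 m) x).symm (α s),
    (chartSymmD x (α 0)).comp (ContinuousLinearMap.toSpanSingleton ℝ u), ?_, ?_, ?_, ?_⟩
  · simp only [hα_zero, extChartAt_to_inv]
  · rw [hα_zero]
    exact (chartSymmD_self_apply _).trans (one_smul ℝ u)
  · have hsymm : HasMFDerivAt 𝓘(ℝ, EuclideanSpace ℝ (Fin m)) (𝓡 m) (extChartAt (𝓡 m) x).symm (α 0)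
        (chartSymmD x (α 0)) := hasMFDerivAt_chart_symm (by rw [hα_zero]; exact hx.1)
    exact HasMFDerivAt.comp 0 hsymm hα.hasFDerivAt.hasMFDerivAt
  · filter_upwards [hα_fibre, hα_lim.eventually hdomain] with s hs hsdomain
    refine ⟨ContinuousAt.comp (f := α) (continuousAt_extChartAt_symm'' hsdomain.1) hs.1, ?_⟩
    refine (extChartAt (𝓡 n) (f x)).injOn hsdomain.2 (mem_extChartAt_source _) (hs.2.trans ?_)
    exact congrArg (fun y => extChartAt (𝓡 n) (f x) (f y)) (extChartAt_to_inv x)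

variable {F : ∀ q : Q, Submodule ℝ (TangentSpace (𝓡 n) q)} {r : ℕ}

theorem IsDistribution.finrank_eq (hd : IsDistribution F r) (q : Q) :
    Module.finrank ℝ (F q) = r := by
  obtain ⟨U, -, hq, s, -, hs⟩ := hd q
  obtain ⟨hindep, hspan⟩ := hs q hq
  rw [← hspan]
  exact (finrank_span_eq_card hindep).trans (Fintype.card_fin r)

variable [SecondCountableTopology Q]

theorem mfderiv_mem_of_reachable (hd : IsDistribution F r) (hF : IsInvolutive F) {f g : M → Q}
    (hf : IsSmoothSubmersion (m := m) (n := n) f) (hg : ContMDiff (𝓡 m) (𝓡 n) ∞ g)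
    (hr : ∀ x, Reachable F (f x) (g x) ∨ Reachable F (g x) (f x)) {x : M}
    {u : TangentSpace (𝓡 m) x} (hu : mfderiv (𝓡 m) (𝓡 n) f x u = 0) :
    mfderiv (𝓡 m) (𝓡 n) g x u ∈ F (g x) := by
  obtain ⟨γ, v, rfl, rfl, hγ, hfibre⟩ := hf.exists_curve hu
  have hg' := (hg.mdifferentiableAt (by simp) :
    MDifferentiableAt (𝓡 m) (𝓡 n) g (γ 0)).hasMFDerivAt
  refine mem_of_eventually_reachable (q := f (γ 0)) hd hF (HasMFDerivAt.comp 0 hg' hγ) ?_ ?_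
  · filter_upwards [hfibre] with s hs
    exact hg.continuous.continuousAt.comp hs.1
  · filter_upwards [hfibre] with s hs
    rw [← hs.2]
    exact hr (γ s)

theorem map_ker_mfderiv_eq_of_reachable (hd : IsDistribution F r) (hF : IsInvolutive F)
    {f g : M → Q} (hf : IsSmoothSubmersion (m := m) (n := n) f) (hg : ContMDiff (𝓡 m) (𝓡 n) ∞ g)
    (hr : ∀ x, Reachable F (f x) (g x) ∨ Reachable F (g x) (f x)) (hm : m = n + r) {x : M}
    (hdisj : Disjoint (LinearMap.ker (mfderiv (𝓡 m) (𝓡 n) f x).toLinearMap)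
      (LinearMap.ker (mfderiv (𝓡 m) (𝓡 n) g x).toLinearMap)) :
    (LinearMap.ker (mfderiv (𝓡 m) (𝓡 n) f x).toLinearMap).map
      (mfderiv (𝓡 m) (𝓡 n) g x).toLinearMap = F (g x) := by
  have hle : (LinearMap.ker (mfderiv (𝓡 m) (𝓡 n) f x).toLinearMap).map
      (mfderiv (𝓡 m) (𝓡 n) g x).toLinearMap ≤ F (g x) := by
    rintro _ ⟨u, hu, rfl⟩
    exact mfderiv_mem_of_reachable hd hF hf hg hr hu
  let A : EuclideanSpace ℝ (Fin m) →ₗ[ℝ] EuclideanSpace ℝ (Fin n) :=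
    (mfderiv (𝓡 m) (𝓡 n) f x).toLinearMap
  let B : EuclideanSpace ℝ (Fin m) →ₗ[ℝ] EuclideanSpace ℝ (Fin n) :=
    (mfderiv (𝓡 m) (𝓡 n) g x).toLinearMap
  let S : Submodule ℝ (EuclideanSpace ℝ (Fin n)) := F (g x)
  have hdim : Module.finrank ℝ (EuclideanSpace ℝ (Fin m)) =
      Module.finrank ℝ (EuclideanSpace ℝ (Fin n)) + Module.finrank ℝ S := by
    rw [finrank_euclideanSpace_fin, finrank_euclideanSpace_fin, hm]
    exact congrArg (n + ·) (hd.finrank_eq (g x)).symm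
  exact map_ker_eq_of_finrank_eq (A := A) (B := B) (S := S) (hf.surjective x) hdisj hle hdim

end FibreCurves

/-! ### Holonomic systems -/

section Holonomic

variable {n k r : ℕ} {V Q D : Type*}
  [TopologicalSpace Q] [ChartedSpace (EuclideanSpace ℝ (Fin n)) Q]
  [TopologicalSpace V] [ChartedSpace (EuclideanSpace ℝ (Fin (2 * n))) V]
  [IsManifold (𝓡 (2 * n)) ∞ V]
  [TopologicalSpace D] [ChartedSpace (EuclideanSpace ℝ (Fin k)) D]

theorem forall_mem_cast_iff {F : ∀ q : Q, Submodule ℝ (TangentSpace (𝓡 n) q)} {p q : Q}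
    (h : p = q) (P : TangentSpace (𝓡 n) q → Prop) : (∀ a ∈ F p, P (h ▸ a)) ↔ ∀ a ∈ F q, P a := by
  subst h
  rfl

namespace DCLS

variable [IsManifold (𝓡 n) ∞ Q] (C : DCLS n V Q k D)

theorem mfderiv_plus_incl (x : D) :
    mfderiv (𝓡 k) (𝓡 n) (C.plus ∘ C.incl) x =
      (C.Tplus (C.incl x)).comp (mfderiv (𝓡 k) (𝓡 (2 * n)) C.incl x) :=
  mfderiv_comp x (C.submersion_plus.contMDiff.mdifferentiableAt (by simp))
    (C.embedding_incl.contMDiff.mdifferentiableAt (by simp))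

theorem mfderiv_minus_incl (x : D) :
    mfderiv (𝓡 k) (𝓡 n) (C.minus ∘ C.incl) x =
      (C.Tminus (C.incl x)).comp (mfderiv (𝓡 k) (𝓡 (2 * n)) C.incl x) :=
  mfderiv_comp x (C.submersion_minus.contMDiff.mdifferentiableAt (by simp))
    (C.embedding_incl.contMDiff.mdifferentiableAt (by simp))

theorem disjoint_ker_mfderiv (x : D) :
    Disjoint (LinearMap.ker (mfderiv (𝓡 k) (𝓡 n) (C.plus ∘ C.incl) x).toLinearMap)
      (LinearMap.ker (mfderiv (𝓡 k) (𝓡 n) (C.minus ∘ C.incl) x).toLinearMap) := by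
  rw [mfderiv_plus_incl, mfderiv_minus_incl, LinearMap.disjoint_ker]
  intro u hplus hminus
  exact C.embedding_incl.injective x ((C.ker_inf_ker _ _ hplus hminus).trans (map_zero _).symm)

theorem vertPlus_inf_tangentD (x : D) :
    C.vertPlus (C.incl x) ⊓ C.tangentD x =
      (LinearMap.ker (mfderiv (𝓡 k) (𝓡 n) (C.plus ∘ C.incl) x).toLinearMap).map
        (mfderiv (𝓡 k) (𝓡 (2 * n)) C.incl x).toLinearMap := by
  rw [mfderiv_plus_incl, inf_comm]
  exact (Submodule.map_comap_eq _ _).symm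

theorem vertMinus_inf_tangentD (x : D) :
    C.vertMinus (C.incl x) ⊓ C.tangentD x =
      (LinearMap.ker (mfderiv (𝓡 k) (𝓡 n) (C.minus ∘ C.incl) x).toLinearMap).map
        (mfderiv (𝓡 k) (𝓡 (2 * n)) C.incl x).toLinearMap := by
  rw [mfderiv_minus_incl, inf_comm]
  exact (Submodule.map_comap_eq _ _).symm

variable {C} {F : ∀ q : Q, Submodule ℝ (TangentSpace (𝓡 n) q)}

theorem liftMinus_mem_K0 {v : V} {a : TangentSpace (𝓡 n) (C.minus v)} (ha : a ∈ F (C.minus v)) :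
    C.liftMinus v a ∈ C.K0 F v := by
  refine Submodule.mem_inf.2 ⟨?_, ?_⟩
  · change C.Tminus v (C.liftMinus v a) ∈ F (C.minus v)
    rwa [C.Tminus_liftMinus]
  · change C.Tplus v (C.liftMinus v a) ∈ F (C.plus v)
    rw [C.Tplus_liftMinus]
    exact zero_mem _

theorem liftPlus_mem_K0 {v : V} {b : TangentSpace (𝓡 n) (C.plus v)} (hb : b ∈ F (C.plus v)) :
    C.liftPlus v b ∈ C.K0 F v := by
  refine Submodule.mem_inf.2 ⟨?_, ?_⟩
  · change C.Tminus v (C.liftPlus v b) ∈ F (C.minus v)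
    rw [C.Tminus_liftPlus]
    exact zero_mem _
  · change C.Tplus v (C.liftPlus v b) ∈ F (C.plus v)
    rwa [C.Tplus_liftPlus]

theorem nondegenerate_omegaPlus_iff {v : V} (hclosed : ∀ a b, C.σ.d v a b = 0) :
    (∀ δv ∈ C.K0 F v, (∀ δw ∈ C.K0 F v, C.omegaPlus C.σ v δv δw = 0) → δv = 0) ↔
      (∀ a ∈ F (C.minus v), (∀ b ∈ F (C.plus v), C.dpm C.σ v a b = 0) → a = 0) ∧
        ∀ b ∈ F (C.plus v), (∀ a ∈ F (C.minus v), C.dpm C.σ v a b = 0) → b = 0 := by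
  have hω := C.omegaPlus_eq_dpm C.smooth_σ hclosed
  have hzero_left := C.dpm_zero_left C.smooth_σ v
  have hzero_right := C.dpm_zero_right C.smooth_σ v
  constructor
  · refine fun hnondeg => ⟨fun a ha hab => ?_, fun b hb hab => ?_⟩
    · have hlift : C.liftMinus v a = 0 := hnondeg _ (liftMinus_mem_K0 ha) fun δw hδw => by
        rw [hω, C.Tminus_liftMinus, C.Tplus_liftMinus, hzero_right,
          hab (C.Tplus v δw) hδw.2, sub_zero]
      rw [← C.Tminus_liftMinus v a, hlift, map_zero]
    · have hlift : C.liftPlus v b = 0 := hnondeg _ (liftPlus_mem_K0 hb) fun δw hδw => by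
        rw [hω, C.Tminus_liftPlus, C.Tplus_liftPlus, hzero_left,
          hab (C.Tminus v δw) hδw.1, sub_zero]
      rw [← C.Tplus_liftPlus v b, hlift, map_zero]
  · rintro ⟨hminus, hplus⟩ δv hδv hker
    refine C.ker_inf_ker v δv ?_ ?_
    · refine hplus _ hδv.2 fun a ha => ?_
      have hlift := hker _ (liftMinus_mem_K0 ha)
      rwa [hω, C.Tminus_liftMinus, C.Tplus_liftMinus, hzero_right, sub_zero] at hlift
    · refine hminus _ hδv.1 fun b hb => ?_
      have hlift := hker _ (liftPlus_mem_K0 hb)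
      rwa [hω, C.Tminus_liftPlus, C.Tplus_liftPlus, hzero_left, zero_sub, neg_eq_zero] at hlift

variable [IsManifold (𝓡 k) ∞ D] [SecondCountableTopology Q]

theorem IsHolonomic.map_Tminus (hC : C.IsHolonomic F r) (x : D) :
    (C.vertPlus (C.incl x) ⊓ C.tangentD x).map (C.Tminus (C.incl x)).toLinearMap =
      F (C.minus (C.incl x)) := by
  have hmap := map_ker_mfderiv_eq_of_reachable hC.distribution hC.involutive
    C.submersion_plus_incl C.submersion_minus_incl.contMDiff (fun x => Or.inr (hC.reachable x))
    hC.dim_eq (C.disjoint_ker_mfderiv x)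
  rw [mfderiv_minus_incl] at hmap
  rw [vertPlus_inf_tangentD, ← Submodule.map_comp]
  exact hmap

theorem IsHolonomic.map_Tplus (hC : C.IsHolonomic F r) (x : D) :
    (C.vertMinus (C.incl x) ⊓ C.tangentD x).map (C.Tplus (C.incl x)).toLinearMap =
      F (C.plus (C.incl x)) := by
  have hmap := map_ker_mfderiv_eq_of_reachable hC.distribution hC.involutive
    C.submersion_minus_incl C.submersion_plus_incl.contMDiff (fun x => Or.inl (hC.reachable x))
    hC.dim_eq (C.disjoint_ker_mfderiv x).symm
  rw [mfderiv_plus_incl] at hmap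
  rw [vertMinus_inf_tangentD, ← Submodule.map_comp]
  exact hmap

theorem IsHolonomic.regularMinus_iff (hC : C.IsHolonomic F r)
    (hpred : ∀ x' : D, ∃ x : D, C.plus (C.incl x) = C.minus (C.incl x')) :
    C.RegularMinus ↔ ∀ x : D, ∀ a ∈ F (C.minus (C.incl x)),
      (∀ b ∈ F (C.plus (C.incl x)), C.dpm C.σ (C.incl x) a b = 0) → a = 0 := by
  simp only [RegularMinus, hC.map_Tminus, hC.E_eq]
  refine ⟨fun h x => ?_, fun h _ x _ => h x⟩
  obtain ⟨y, hy⟩ := hpred x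
  exact h y x hy

theorem IsHolonomic.regularPlus_iff (hC : C.IsHolonomic F r)
    (hpred : ∀ x' : D, ∃ x : D, C.plus (C.incl x) = C.minus (C.incl x')) :
    C.RegularPlus ↔ ∀ x : D, ∀ b ∈ F (C.plus (C.incl x)),
      (∀ a ∈ F (C.minus (C.incl x)), C.dpm C.σ (C.incl x) a b = 0) → b = 0 := by
  simp only [RegularPlus, hC.map_Tplus, hC.E_eq]
  have hcast (y x : D) (hy : C.plus (C.incl y) = C.minus (C.incl x))
      (b : TangentSpace (𝓡 n) (C.plus (C.incl x))) :=
    forall_mem_cast_iff (F := F) hy fun a => C.dpm C.σ (C.incl x) a b = 0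
  refine ⟨fun h x b hb hab => ?_, fun h y x hy b hb hab => h x b hb ((hcast y x hy b).1 hab)⟩
  obtain ⟨y, hy⟩ := hpred x
  exact h y x hy b hb ((hcast y x hy b).2 hab)

theorem IsHolonomic.regular_iff (hC : C.IsHolonomic F r)
    (hpred : ∀ x' : D, ∃ x : D, C.plus (C.incl x) = C.minus (C.incl x')) :
    C.Regular ↔ C.NondegenerateOnK0 F (C.omegaPlus C.σ) := by
  rw [Regular, hC.regularMinus_iff hpred, hC.regularPlus_iff hpred, ← forall_and]
  exact forall_congr' fun x => (nondegenerate_omegaPlus_iff (hC.closed (C.incl x))).symm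

end DCLS

end Holonomic

end DiscreteMechanics
end

theorem mainTheorem7 {n k r : ℕ} {V Q D : Type*}
    [TopologicalSpace Q] [T2Space Q] [SecondCountableTopology Q]
    [ChartedSpace (EuclideanSpace ℝ (Fin n)) Q] [IsManifold (𝓡 n) ∞ Q]
    [TopologicalSpace V] [T2Space V] [SecondCountableTopology V]
    [ChartedSpace (EuclideanSpace ℝ (Fin (2 * n))) V] [IsManifold (𝓡 (2 * n)) ∞ V]
    [TopologicalSpace D] [ChartedSpace (EuclideanSpace ℝ (Fin k)) D] [IsManifold (𝓡 k) ∞ D]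
    (C : DiscreteMechanics.DCLS n V Q k D)
    (F : ∀ q : Q, Submodule ℝ (TangentSpace (𝓡 n) q))
    (hC : C.IsHolonomic F r)
    (hpred : ∀ x' : D, ∃ x : D, C.plus (C.incl x) = C.minus (C.incl x')) :
    (∀ (v : V) (δv δw : TangentSpace (𝓡 (2 * n)) v),
      C.omegaPlus C.σ v δv δw = C.omegaMinus C.σ v δv δw) ∧
    (C.Regular ↔ C.NondegenerateOnK0 F (C.omegaPlus C.σ)) :=
  ⟨fun v => C.omegaPlus_eq_omegaMinus C.smooth_σ (hC.closed v), hC.regular_iff hpred⟩
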